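/- **Setting.** Let $d_x,d_u,T\in\mathbb N$. For $t=1,\dots,T$ let $A_t,A^0_t,D_t,D^0_t,E_t,Q_t,Q^0_t,F_t,P_t,H_t\in\mathbb R^{d_x\times d_x}$, $B_t,B^0_t\in\mathbb R^{d_x\times d_u}$ and $R_t,R^0_t\in\mathbb R^{d_u\times d_u}$, none of them depending on the number $n$ of followers, with $Q_t,Q^0_t,F_t,P_t,H_t,R_t,R^0_t$ symmetric. For $n\ge 1$ followers $i=1,\dots,n$ and a leader ($i=0$), with $\bar x_t=\frac1n\sum_{i=1}^n x^i_t$, consider $$x^0_{t+1}=A^0_tx^0_t+B^0_tu^0_t+D^0_t\bar x_t+w^0_t,\qquad x^i_{t+1}=A_tx^i_t+B_tu^i_t+D_t\bar x_t+E_tx^0_t+w^i_t\quad(1\le i\le n),$$ and, for a strategy $g$ (a choice of measurable control laws determining the actions), the cost $$J_T(g)=\mathbb E\Big[\sum_{t=1}^T (x^0_t)^\top Q^0_tx^0_t+(\bar x_t-x^0_t)^\top F_t(\bar x_t-x^0_t)+(u^0_t)^\top R^0_tu^0_t+\frac1n\sum_{i=1}^n\big((x^i_t)^\top Q_tx^i_t+(x^i_t-x^0_t)^\top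 P_t(x^i_t-x^0_t)+(u^i_t)^\top R_tu^i_t\big)+\frac1{2n^2}\sum_{i,j=1}^n(x^i_t-x^j_t)^\top H_t(x^i_t-x^j_t)\Big].$$ A strategy is *decentralized* if $u^0_t$ is a function of $x^0_{1:t}$ and $u^i_t$ is a function of $(x^i_{1:t},x^0_{1:t})$ (this includes control laws that use only $x^0_t$, respectively $(x^i_t,x^0_t)$). It is a *mean-field sharing* strategy if every agent may in addition use $\bar x_{1:t}$; $J_T^*$ denotes the infimum of $J_T$ over the mean-field sharing strategies. **Riccati equations.** Let $$\bar A_t=\begin{bmatrix}A^0_t&D^0_t\\E_t&A_t+D_t\end{bmatrix},\ \bar B_t=\begin{bmatrix}B^0_t&0\\0&B_t\end{bmatrix},\ \bar Q_t=\begin{bmatrix}Q^0_t+P_t+F_t&-P_t-F_t\\-P_t-F_t&Q_t+P_t+F_t\end{bmatrix},\ \bar R_t=\begin{bmatrix}R^0_t&0\\0&R_t\end{bmatrix},$$ let $\breve M_{T+1}=0$, $\bar M_{T+1}=0$ and, for $t=T,\dots,1$, $$\breve M_t=A_t^\top\breve M_{t+1}A_t-A_t^\top\breve M_{t+1}B_t(B_t^\top\breve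 M_{t+1}B_t+R_t)^{-1}B_t^\top\breve M_{t+1}A_t+Q_t+P_t+H_t,$$ $$\bar M_t=\bar A_t^\top\bar M_{t+1}\bar A_t-\bar A_t^\top\bar M_{t+1}\bar B_t(\bar B_t^\top\bar M_{t+1}\bar B_t+\bar R_t)^{-1}\bar B_t^\top\bar M_{t+1}\bar A_t+\bar Q_t,$$ $$\breve L_t=-(B_t^\top\breve M_{t+1}B_t+R_t)^{-1}B_t^\top\breve M_{t+1}A_t,\qquad \bar L_t=\begin{bmatrix}\bar L^{1,1}_t&\bar L^{1,2}_t\\\bar L^{2,1}_t&\bar L^{2,2}_t\end{bmatrix}=-(\bar B_t^\top\bar M_{t+1}\bar B_t+\bar R_t)^{-1}\bar B_t^\top\bar M_{t+1}\bar A_t.$$ **Assumptions.** For every $t\in\{1,\dots,T\}$, $Q_t+P_t+H_t$ and $\bar Q_t$ are positive semi-definite and $R_t$, $R^0_t$ are positive definite. All initial states $x^0_1,x^1_1,\dots,x^n_1$ and noises $w^i_t$ ($0\le i\le n$, $1\le t\le T$) are mutually independent and square integrable, and all noises have mean zero. The followers' initial states are i.i.d. with mean $\mu_x$ and covariance matrix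 $\Sigma_x$, the followers' noises are i.i.d. with covariance matrix $\Sigma_w$, and $\Sigma_x,\Sigma_w$ do not depend on $n$. **Theorem 2.** Let $g^*_\varepsilon$ be the strategy $$u^0_t=\bar L^{1,1}_tx^0_t+\bar L^{1,2}_tz_t,\qquad u^i_t=\breve L_tx^i_t+\bar L^{2,1}_tx^0_t+(\bar L^{2,2}_t-\breve L_t)z_t,$$ where $z_1=\mu_x$ and $z_{t+1}=(A_t+B_t\bar L^{2,2}_t+D_t)z_t+(B_t\bar L^{2,1}_t+E_t)x^0_t$. There is a function $\varepsilon(n)\ge 0$ with $\varepsilon(n)=O(1/n)$ (hence $\varepsilon(n)\to0$), depending only on $T$, the system and cost matrices, $\Sigma_x$ and $\Sigma_w$, such that for every $n\ge1$: the strategy $g^*_\varepsilon$ is decentralized; $J_T(g^*_\varepsilon)\le J_T(g)+\varepsilon(n)$ for every decentralized strategy $g$; $J_T^*$ is attained by the mean-field sharing strategy $u^0_t=\bar L^{1,1}_tx^0_t+\bar L^{1,2}_t\bar x_t$, $u^i_t=\breve L_tx^i_t+\bar L^{2,1}_tx^0_t+(\bar L^{2,2}_t-\breve L_t)\bar x_t$;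 and $J_T(g^*_\varepsilon)$ and $J_T^*$ are finite with $$|J_T(g^*_\varepsilon)-J_T^*|\le\varepsilon(n).$$ -/

import Mathlib

open MeasureTheory ProbabilityTheory Matrix Filter Topology Asymptotics
open scoped ENNReal

namespace LeaderFollower

/-- The matrices of a leader-follower system with state dimension `dx` and action dimension `du`.
Time is counted from `0`: index `t` here is time `t + 1` when time is counted from `1`, so a
horizon `T` consists of the times `0, …, T - 1`. -/
structure LQSystem (dx du : ℕ) where
  A0 : ℕ → Matrix (Fin dx) (Fin dx) ℝ
  B0 : ℕ → Matrix (Fin dx) (Fin du) ℝ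
  D0 : ℕ → Matrix (Fin dx) (Fin dx) ℝ
  A : ℕ → Matrix (Fin dx) (Fin dx) ℝ
  B : ℕ → Matrix (Fin dx) (Fin du) ℝ
  D : ℕ → Matrix (Fin dx) (Fin dx) ℝ
  E : ℕ → Matrix (Fin dx) (Fin dx) ℝ
  Q0 : ℕ → Matrix (Fin dx) (Fin dx) ℝ
  F : ℕ → Matrix (Fin dx) (Fin dx) ℝ
  R0 : ℕ → Matrix (Fin du) (Fin du) ℝ
  Q : ℕ → Matrix (Fin dx) (Fin dx) ℝ
  P : ℕ → Matrix (Fin dx) (Fin dx) ℝ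
  R : ℕ → Matrix (Fin du) (Fin du) ℝ
  H : ℕ → Matrix (Fin dx) (Fin dx) ℝ

/-- The agents: `none` is the leader, `some i` is follower `i`. -/
abbrev Agent (n : ℕ) := Option (Fin n)

/-- Joint states of all agents (also used for joint noises). -/
abbrev State (dx n : ℕ) := Agent n → Fin dx → ℝ

/-- Joint actions of all agents. -/
abbrev Action (du n : ℕ) := Agent n → Fin du → ℝ

/-- The average of the followers' components (the mean-field). -/
noncomputable def avg {d n : ℕ} (x : Agent n → Fin d → ℝ) : Fin d → ℝ :=
  (n : ℝ)⁻¹ • ∑ i : Fin n, x (some i)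

/-- The quadratic form `vᵀ M v`. -/
noncomputable def quad {d : ℕ} (M : Matrix (Fin d) (Fin d) ℝ) (v : Fin d → ℝ) : ℝ :=
  v ⬝ᵥ (M *ᵥ v)

/-- A strategy, before any restriction on the information: at time `t` the joint history of states
`x_0, …, x_t` is mapped to the actions of all agents. -/
abbrev Strategy (dx du n : ℕ) := (t : ℕ) → (Fin (t + 1) → State dx n) → Action du n

/-- The decentralized information structure: the leader's action is a measurable function of the
leader's states, follower `i`'s action is a measurable function of its own states and of the
leader's states. Past observations are remembered; control laws that use only the current
observations are the special case where `φ` depends on the last entry of each history. -/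
def IsDecentralized {dx du n : ℕ} (g : Strategy dx du n) : Prop :=
  (∀ t, ∃ φ : (Fin (t + 1) → Fin dx → ℝ) → Fin du → ℝ, Measurable φ ∧
    ∀ h, g t h none = φ (fun s => h s none)) ∧
  ∀ (i : Fin n) (t : ℕ),
    ∃ φ : (Fin (t + 1) → Fin dx → ℝ) × (Fin (t + 1) → Fin dx → ℝ) → Fin du → ℝ,
      Measurable φ ∧ ∀ h, g t h (some i) = φ (fun s => h s (some i), fun s => h s none)

/-- The mean-field sharing information structure: in addition to the observations of the
decentralized information structure, every agent observes the mean-field. -/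
def IsMeanFieldSharing {dx du n : ℕ} (g : Strategy dx du n) : Prop :=
  (∀ t, ∃ φ : (Fin (t + 1) → Fin dx → ℝ) × (Fin (t + 1) → Fin dx → ℝ) → Fin du → ℝ,
    Measurable φ ∧ ∀ h, g t h none = φ (fun s => h s none, fun s => avg (h s))) ∧
  ∀ (i : Fin n) (t : ℕ),
    ∃ φ : (Fin (t + 1) → Fin dx → ℝ) × (Fin (t + 1) → Fin dx → ℝ) ×
        (Fin (t + 1) → Fin dx → ℝ) → Fin du → ℝ,
      Measurable φ ∧ ∀ h, g t h (some i) =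
        φ (fun s => h s (some i), fun s => h s none, fun s => avg (h s))

/-- The expectation of a real random variable in the extended sense, `E[f⁺] - E[f⁻]`. -/
noncomputable def extExpectation {Ω : Type*} [MeasurableSpace Ω] (μ : Measure Ω) (f : Ω → ℝ) :
    EReal :=
  ((∫⁻ ω, ENNReal.ofReal (f ω) ∂μ : ℝ≥0∞) : EReal) -
    ((∫⁻ ω, ENNReal.ofReal (-f ω) ∂μ : ℝ≥0∞) : EReal)

/-- The solution `M` of the Riccati recursion in terms of the time to go: the value at `k` is
`M_{T-k}`. -/
noncomputable def riccatiToGo {ι κ : Type*} [Fintype ι] [Fintype κ] [DecidableEq κ]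
    (A : ℕ → Matrix ι ι ℝ) (B : ℕ → Matrix ι κ ℝ) (Q : ℕ → Matrix ι ι ℝ) (R : ℕ → Matrix κ κ ℝ)
    (T : ℕ) : ℕ → Matrix ι ι ℝ
  | 0 => 0
  | k + 1 =>
    let M := riccatiToGo A B Q R T k
    let t := T - 1 - k
    (A t)ᵀ * M * A t - (A t)ᵀ * M * B t * ((B t)ᵀ * M * B t + R t)⁻¹ * (B t)ᵀ * M * A t + Q t

/-- The solution `M_t`, `t ≤ T`, of the Riccati equation with terminal value `M_T = 0`. -/
noncomputable def riccati {ι κ : Type*} [Fintype ι] [Fintype κ] [DecidableEq κ]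
    (A : ℕ → Matrix ι ι ℝ) (B : ℕ → Matrix ι κ ℝ) (Q : ℕ → Matrix ι ι ℝ) (R : ℕ → Matrix κ κ ℝ)
    (T t : ℕ) : Matrix ι ι ℝ :=
  riccatiToGo A B Q R T (T - t)

theorem riccati_terminal {ι κ : Type*} [Fintype ι] [Fintype κ] [DecidableEq κ]
    (A : ℕ → Matrix ι ι ℝ) (B : ℕ → Matrix ι κ ℝ) (Q : ℕ → Matrix ι ι ℝ) (R : ℕ → Matrix κ κ ℝ)
    (T : ℕ) : riccati A B Q R T T = 0 := by
  simp [riccati, riccatiToGo]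

theorem riccati_step {ι κ : Type*} [Fintype ι] [Fintype κ] [DecidableEq κ]
    (A : ℕ → Matrix ι ι ℝ) (B : ℕ → Matrix ι κ ℝ) (Q : ℕ → Matrix ι ι ℝ) (R : ℕ → Matrix κ κ ℝ)
    (T t : ℕ) (ht : t < T) :
    riccati A B Q R T t =
      (A t)ᵀ * riccati A B Q R T (t + 1) * A t
        - (A t)ᵀ * riccati A B Q R T (t + 1) * B t
          * ((B t)ᵀ * riccati A B Q R T (t + 1) * B t + R t)⁻¹
          * (B t)ᵀ * riccati A B Q R T (t + 1) * A t
        + Q t := by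
  have h1 : T - t = (T - (t + 1)) + 1 := by omega
  have h2 : T - 1 - (T - (t + 1)) = t := by omega
  unfold riccati
  rw [h1]
  simp only [riccatiToGo, h2]

/-- The feedback gain `L_t = -(BᵀM_{t+1}B + R)⁻¹ BᵀM_{t+1}A`. -/
noncomputable def gain {ι κ : Type*} [Fintype ι] [Fintype κ] [DecidableEq κ]
    (A : ℕ → Matrix ι ι ℝ) (B : ℕ → Matrix ι κ ℝ) (Q : ℕ → Matrix ι ι ℝ) (R : ℕ → Matrix κ κ ℝ)
    (T t : ℕ) : Matrix κ ι ℝ :=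
  -(((B t)ᵀ * riccati A B Q R T (t + 1) * B t + R t)⁻¹
      * (B t)ᵀ * riccati A B Q R T (t + 1) * A t)

namespace LQSystem

variable {dx du : ℕ} (S : LQSystem dx du)

/-- One step of the dynamics. -/
noncomputable def step {n : ℕ} (t : ℕ) (x : State dx n) (u : Action du n) (w : State dx n) :
    State dx n
  | none => S.A0 t *ᵥ x none + S.B0 t *ᵥ u none + S.D0 t *ᵥ avg x + w none
  | some i =>
      S.A t *ᵥ x (some i) + S.B t *ᵥ u (some i) + S.D t *ᵥ avg x + S.E t *ᵥ x none + w (some i)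

/-- The history of joint states up to time `t` under the strategy `g`, for the initial state `x1`
and the noise sequence `w`. -/
noncomputable def history {n : ℕ} (g : Strategy dx du n) (x1 : State dx n) (w : ℕ → State dx n) :
    (t : ℕ) → Fin (t + 1) → State dx n
  | 0 => fun _ => x1
  | t + 1 =>
    let h := history g x1 w t
    Fin.snoc (α := fun _ => State dx n) h (S.step t (h (Fin.last t)) (g t h) (w t))

/-- The joint state at time `t`. -/
noncomputable def state {n : ℕ} (g : Strategy dx du n) (x1 : State dx n) (w : ℕ → State dx n)
    (t : ℕ) : State dx n :=
  S.history g x1 w t (Fin.last t)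

/-- The joint action at time `t`. -/
noncomputable def action {n : ℕ} (g : Strategy dx du n) (x1 : State dx n) (w : ℕ → State dx n)
    (t : ℕ) : Action du n :=
  g t (S.history g x1 w t)

/-- The per-step cost. -/
noncomputable def stageCost {n : ℕ} (t : ℕ) (x : State dx n) (u : Action du n) : ℝ :=
  quad (S.Q0 t) (x none) + quad (S.F t) (avg x - x none) + quad (S.R0 t) (u none)
    + 1 / (n : ℝ) * ∑ i : Fin n, (quad (S.Q t) (x (some i))
        + quad (S.P t) (x (some i) - x none) + quad (S.R t) (u (some i)))
    + 1 / (2 * (n : ℝ) ^ 2) * ∑ i : Fin n, ∑ j : Fin n, quad (S.H t) (x (some i) - x (some j))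

/-- The realized total cost over the horizon `T`. -/
noncomputable def totalCost {n : ℕ} (T : ℕ) (g : Strategy dx du n) (x1 : State dx n)
    (w : ℕ → State dx n) : ℝ :=
  ∑ t ∈ Finset.range T, S.stageCost t (S.state g x1 w t) (S.action g x1 w t)

/-- The cost functional `J_T(g)`, for the initial states `init` and the noises `noise`. -/
noncomputable def cost {n : ℕ} (T : ℕ) {Ω : Type*} [MeasurableSpace Ω] (μ : Measure Ω)
    (init : Agent n → Ω → Fin dx → ℝ) (noise : ℕ → Agent n → Ω → Fin dx → ℝ)
    (g : Strategy dx du n) : EReal :=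
  extExpectation μ (fun ω => S.totalCost T g (fun a => init a ω) (fun t a => noise t a ω))

/-- The optimal performance `J_T^*`: the least cost when the mean-field is shared. -/
noncomputable def optimalCost {n : ℕ} (T : ℕ) {Ω : Type*} [MeasurableSpace Ω] (μ : Measure Ω)
    (init : Agent n → Ω → Fin dx → ℝ) (noise : ℕ → Agent n → Ω → Fin dx → ℝ) : EReal :=
  ⨅ g : {g : Strategy dx du n // IsMeanFieldSharing g}, S.cost T μ init noise g.1

noncomputable def Abar (t : ℕ) : Matrix (Fin dx ⊕ Fin dx) (Fin dx ⊕ Fin dx) ℝ :=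
  fromBlocks (S.A0 t) (S.D0 t) (S.E t) (S.A t + S.D t)

noncomputable def Bbar (t : ℕ) : Matrix (Fin dx ⊕ Fin dx) (Fin du ⊕ Fin du) ℝ :=
  fromBlocks (S.B0 t) 0 0 (S.B t)

noncomputable def Qbar (t : ℕ) : Matrix (Fin dx ⊕ Fin dx) (Fin dx ⊕ Fin dx) ℝ :=
  fromBlocks (S.Q0 t + S.P t + S.F t) (-S.P t - S.F t) (-S.P t - S.F t) (S.Q t + S.P t + S.F t)

noncomputable def Rbar (t : ℕ) : Matrix (Fin du ⊕ Fin du) (Fin du ⊕ Fin du) ℝ :=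
  fromBlocks (S.R0 t) 0 0 (S.R t)

/-- The gain of the first Riccati equation (deviations from the mean-field). -/
noncomputable def Lbreve (T t : ℕ) : Matrix (Fin du) (Fin dx) ℝ :=
  gain S.A S.B (fun s => S.Q s + S.P s + S.H s) S.R T t

/-- The gain of the second Riccati equation (leader and mean-field). -/
noncomputable def Lbar (T t : ℕ) : Matrix (Fin du ⊕ Fin du) (Fin dx ⊕ Fin dx) ℝ :=
  gain S.Abar S.Bbar S.Qbar S.Rbar T t

/-- The sequence `z` driven by a path `p` of leader states, started at `m`. -/
noncomputable def zPath (T : ℕ) (m : Fin dx → ℝ) (p : ℕ → Fin dx → ℝ) : ℕ → Fin dx → ℝ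
  | 0 => m
  | t + 1 =>
    (S.A t + S.B t * (S.Lbar T t).toBlocks₂₂ + S.D t) *ᵥ zPath T m p t
      + (S.B t * (S.Lbar T t).toBlocks₂₁ + S.E t) *ᵥ p t

/-- The proposed decentralized strategy. The clamped index `min s t` only serves to read the
history `x^0_0, …, x^0_t` as a path; `z_t` uses its entries before time `t`. -/
noncomputable def proposedStrategy (n T : ℕ) (m : Fin dx → ℝ) : Strategy dx du n := fun t h =>
  let z : Fin dx → ℝ := S.zPath T m (fun s => h ⟨min s t, by omega⟩ none) t
  fun
  | none => (S.Lbar T t).toBlocks₁₁ *ᵥ h (Fin.last t) none + (S.Lbar T t).toBlocks₁₂ *ᵥ z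
  | some i =>
      S.Lbreve T t *ᵥ h (Fin.last t) (some i)
        + (S.Lbar T t).toBlocks₂₁ *ᵥ h (Fin.last t) none
        + ((S.Lbar T t).toBlocks₂₂ - S.Lbreve T t) *ᵥ z

/-- The linear mean-field feedback strategy. -/
noncomputable def linearStrategy (n T : ℕ) : Strategy dx du n := fun t h =>
  let x := h (Fin.last t)
  fun
  | none => (S.Lbar T t).toBlocks₁₁ *ᵥ x none + (S.Lbar T t).toBlocks₁₂ *ᵥ avg x
  | some i =>
      S.Lbreve T t *ᵥ x (some i) + (S.Lbar T t).toBlocks₂₁ *ᵥ x none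
        + ((S.Lbar T t).toBlocks₂₂ - S.Lbreve T t) *ᵥ avg x

/-- The weight matrices of the cost are symmetric. -/
structure SymmetricWeights (T : ℕ) : Prop where
  Q0 : ∀ t < T, (S.Q0 t).IsSymm
  F : ∀ t < T, (S.F t).IsSymm
  R0 : ∀ t < T, (S.R0 t).IsSymm
  Q : ∀ t < T, (S.Q t).IsSymm
  P : ∀ t < T, (S.P t).IsSymm
  R : ∀ t < T, (S.R t).IsSymm
  H : ∀ t < T, (S.H t).IsSymm

/-- The definiteness assumptions on the weights. -/
structure PositiveWeights (T : ℕ) : Prop where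
  QPH : ∀ t < T, (S.Q t + S.P t + S.H t).PosSemidef
  Qbar : ∀ t < T, (S.Qbar t).PosSemidef
  R : ∀ t < T, (S.R t).PosDef
  R0 : ∀ t < T, (S.R0 t).PosDef

end LQSystem

/-- The family of all primitive random variables up to the horizon `T`: initial states and noises
of all agents. -/
def primitives {dx n : ℕ} (T : ℕ) {Ω : Type*} (init : Agent n → Ω → Fin dx → ℝ)
    (noise : ℕ → Agent n → Ω → Fin dx → ℝ) : Agent n ⊕ (Fin T × Agent n) → Ω → Fin dx → ℝ
  | Sum.inl a => init a
  | Sum.inr (t, a) => noise t a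

/-- The probabilistic assumptions: the primitive random variables are mutually independent and
square integrable, all noises are centered, the followers' initial states are identically
distributed with mean `m` and covariance matrix `covX`, and the followers' noises are identically
distributed with covariance matrix `covW`. No identity of the laws at different times is needed. -/
structure PrimitiveAssumptions {dx n : ℕ} (T : ℕ) {Ω : Type*} [MeasurableSpace Ω] (μ : Measure Ω)
    (init : Agent n → Ω → Fin dx → ℝ) (noise : ℕ → Agent n → Ω → Fin dx → ℝ)
    (m : Fin dx → ℝ) (covX covW : Matrix (Fin dx) (Fin dx) ℝ) : Prop where
  measurable_init : ∀ a, Measurable (init a)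
  measurable_noise : ∀ t < T, ∀ a, Measurable (noise t a)
  indep : iIndepFun (primitives T init noise) μ
  memLp_init : ∀ a, MemLp (init a) 2 μ
  memLp_noise : ∀ t < T, ∀ a, MemLp (noise t a) 2 μ
  noise_mean : ∀ t < T, ∀ a k, ∫ ω, noise t a ω k ∂μ = 0
  init_ident : ∀ i j : Fin n, IdentDistrib (init (some i)) (init (some j)) μ μ
  init_mean : ∀ (i : Fin n) k, ∫ ω, init (some i) ω k ∂μ = m k
  init_cov : ∀ (i : Fin n) k l,
    cov[fun ω => init (some i) ω k, fun ω => init (some i) ω l; μ] = covX k l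
  noise_ident : ∀ t < T, ∀ i j : Fin n, IdentDistrib (noise t (some i)) (noise t (some j)) μ μ
  noise_cov : ∀ t < T, ∀ (i : Fin n) k l,
    cov[fun ω => noise t (some i) ω k, fun ω => noise t (some i) ω l; μ] = covW k l

end LeaderFollower

open LeaderFollower

/-!
The theorem is an exact completion of squares followed by a law-of-large-numbers estimate.

*Decoupling.* In the coordinates "deviations `xⁱ - x̄` of the followers" and "pair `(x⁰, x̄)`", both
the dynamics and the stage cost separate (`LQSystem.dev_step`, `LQSystem.leaderMean_step`,
`LQSystem.stageCost_eq`), because the deviations sum to zero and are therefore orthogonal to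
constants. Each coordinate carries a standard linear-quadratic problem, whose value function is
given by one of the two Riccati equations.

*Completion of squares.* One Riccati step rewrites stage cost plus value of the noiseless successor
as the present value plus a nonnegative excess, which vanishes exactly along the optimal feedback
(`riccati_completion`, `LQSystem.stageCost_add_value`). The noise is centered and independent of the
history, so in expectation it only adds its own value (`integral_bilinear_add_of_indepFun`).
Telescoping gives `J(g) = baseCost + ∑ₜ 𝔼 excessₜ`, where the first term does not depend on the
strategy `g` (`LQSystem.cost_eq_baseCost_add`). This needs square integrable actions. The stage cost
is nonnegative and coercive in the actions, so a strategy either has square integrable actions or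
has cost `⊤`. Hence `baseCost` is a lower bound, and the linear mean-field feedback, which has no
excess, attains it (`LQSystem.optimalCost_eq`).

*The decentralized strategy.* It replaces `x̄` by `z` in the feedback law. The deviations are still
controlled optimally and the excess is a quadratic form in `x̄ - z` (`LQSystem.excess_feedback`). This
error obeys a linear recursion that does not involve the leader's state, driven by the averaged
noise (`LQSystem.avg_state_sub_zPath_succ`). It is thus bounded by the initial sampling error and the
averaged noises with constants independent of `n`, and averages of `n` independent vectors have mean
square error `trace / n` (`integral_avg_sub_sq`).
-/

namespace LeaderFollower

/-! ### Quadratic forms and the Riccati recursion -/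

section QuadraticForms

theorem isSymm_of_isHermitian {ι : Type*} {M : Matrix ι ι ℝ} (h : M.IsHermitian) : M.IsSymm := by
  rw [IsHermitian, conjTranspose_eq_transpose_of_trivial] at h
  exact h

variable {ι κ : Type*} [Fintype ι] [Fintype κ]

/-- The quadratic form `vᵀ M v` over an arbitrary finite index type; it extends `quad`, which is
restricted to `Fin d`, to the block vectors indexed by a sum type. -/
noncomputable def quadForm (M : Matrix ι ι ℝ) (v : ι → ℝ) : ℝ :=
  v ⬝ᵥ (M *ᵥ v)

theorem quad_eq_quadForm {d : ℕ} (M : Matrix (Fin d) (Fin d) ℝ) (v : Fin d → ℝ) :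
    quad M v = quadForm M v := rfl

@[simp] theorem quadForm_zero (M : Matrix ι ι ℝ) : quadForm M 0 = 0 := by
  simp [quadForm]

theorem quadForm_add_left (M N : Matrix ι ι ℝ) (v : ι → ℝ) :
    quadForm (M + N) v = quadForm M v + quadForm N v := by
  simp [quadForm, add_mulVec, dotProduct_add]

theorem quadForm_sub_left (M N : Matrix ι ι ℝ) (v : ι → ℝ) :
    quadForm (M - N) v = quadForm M v - quadForm N v := by
  simp [quadForm, sub_mulVec, dotProduct_sub]

theorem quadForm_neg (M : Matrix ι ι ℝ) (v : ι → ℝ) : quadForm M (-v) = quadForm M v := by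
  simp [quadForm, mulVec_neg]

theorem quadForm_add (M : Matrix ι ι ℝ) (v w : ι → ℝ) :
    quadForm M (v + w) = quadForm M v + quadForm M w + (v ⬝ᵥ (M *ᵥ w) + w ⬝ᵥ (M *ᵥ v)) := by
  simp only [quadForm, mulVec_add, dotProduct_add, add_dotProduct]
  ring

theorem quadForm_smul (M : Matrix ι ι ℝ) (c : ℝ) (v : ι → ℝ) :
    quadForm M (c • v) = c ^ 2 * quadForm M v := by
  simp only [quadForm, mulVec_smul, dotProduct_smul, smul_dotProduct, smul_eq_mul]
  ring

theorem dotProduct_mulVec_eq_transpose (M : Matrix ι κ ℝ) (v : ι → ℝ) (w : κ → ℝ) :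
    v ⬝ᵥ (M *ᵥ w) = (Mᵀ *ᵥ v) ⬝ᵥ w := by
  rw [dotProduct_mulVec, mulVec_transpose]

theorem quadForm_mulVec (M : Matrix ι ι ℝ) (A : Matrix ι κ ℝ) (v : κ → ℝ) :
    quadForm M (A *ᵥ v) = quadForm (Aᵀ * M * A) v := by
  simp only [quadForm]
  rw [dotProduct_comm, dotProduct_mulVec_eq_transpose, dotProduct_comm]
  simp only [mulVec_mulVec, Matrix.mul_assoc]

theorem quadForm_nonneg {M : Matrix ι ι ℝ} (hM : M.PosSemidef) (v : ι → ℝ) :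
    0 ≤ quadForm M v := by
  simpa [quadForm] using hM.dotProduct_mulVec_nonneg v

theorem posSemidef_of_quadForm_nonneg {M : Matrix ι ι ℝ} (hs : M.IsSymm)
    (h : ∀ v, 0 ≤ quadForm M v) : M.PosSemidef := by
  refine PosSemidef.of_dotProduct_mulVec_nonneg ?_ fun v => by simpa [quadForm] using h v
  rw [IsHermitian, conjTranspose_eq_transpose_of_trivial]
  exact hs

theorem posDef_control_weight {B : Matrix ι κ ℝ} {M : Matrix ι ι ℝ} {R : Matrix κ κ ℝ}
    (hM : M.PosSemidef) (hR : R.PosDef) : (Bᵀ * M * B + R).PosDef := by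
  have := hM.conjTranspose_mul_mul_same B
  rw [conjTranspose_eq_transpose_of_trivial] at this
  exact Matrix.PosDef.posSemidef_add this hR

/-- A quadratic form is bounded by a multiple of the sum of squares. -/
theorem exists_quadForm_le (M : Matrix ι ι ℝ) :
    ∃ C : ℝ, 0 ≤ C ∧ ∀ v : ι → ℝ, quadForm M v ≤ C * (v ⬝ᵥ v) := by
  refine ⟨∑ i, ∑ j, |M i j|, by positivity, fun v => ?_⟩
  have hsq : ∀ i, v i ^ 2 ≤ v ⬝ᵥ v := fun i => by
    rw [dotProduct, sq]
    exact Finset.single_le_sum (f := fun i => v i * v i) (fun j _ => mul_self_nonneg (v j))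
      (Finset.mem_univ i)
  have hsum : quadForm M v = ∑ i, ∑ j, v i * (M i j * v j) := by
    simp only [quadForm, dotProduct, mulVec, Finset.mul_sum]
  rw [hsum, Finset.sum_mul]
  refine Finset.sum_le_sum fun i _ => ?_
  rw [Finset.sum_mul]
  refine Finset.sum_le_sum fun j _ => ?_
  have h1 : |v i * v j| ≤ v ⬝ᵥ v := by
    rw [abs_le]
    constructor <;> nlinarith [hsq i, hsq j, sq_nonneg (v i + v j), sq_nonneg (v i - v j)]
  calc v i * (M i j * v j) = M i j * (v i * v j) := by ring
    _ ≤ |M i j * (v i * v j)| := le_abs_self _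
    _ = |M i j| * |v i * v j| := abs_mul _ _
    _ ≤ |M i j| * (v ⬝ᵥ v) := by gcongr

/-- A positive definite form is coercive: it attains a positive minimum on the unit sphere. -/
theorem exists_le_quadForm {M : Matrix ι ι ℝ} (hM : M.PosDef) :
    ∃ c : ℝ, 0 < c ∧ ∀ v : ι → ℝ, c * ‖v‖ ^ 2 ≤ quadForm M v := by
  have hcont : Continuous (quadForm M) := by
    unfold quadForm
    fun_prop
  rcases (Metric.sphere (0 : ι → ℝ) 1).eq_empty_or_nonempty with he | hne
  · refine ⟨1, one_pos, fun v => ?_⟩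
    by_cases hv : v = 0
    · simp [hv]
    · exfalso
      have : (‖v‖⁻¹ • v) ∈ Metric.sphere (0 : ι → ℝ) 1 := by
        simp [norm_smul, norm_ne_zero_iff.2 hv]
      rw [he] at this
      exact this
  · obtain ⟨v0, hv0, hmin⟩ := (isCompact_sphere (0 : ι → ℝ) 1).exists_isMinOn hne
      hcont.continuousOn
    have hv0' : v0 ≠ 0 := by
      rintro rfl
      simp at hv0
    refine ⟨quadForm M v0, ?_, fun v => ?_⟩
    · simpa [quadForm] using hM.dotProduct_mulVec_pos hv0'
    · by_cases hv : v = 0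
      · simp [hv]
      · have hn : ‖v‖ ≠ 0 := norm_ne_zero_iff.2 hv
        have hmem : (‖v‖⁻¹ • v) ∈ Metric.sphere (0 : ι → ℝ) 1 := by
          simp [norm_smul, hn]
        have h := isMinOn_iff.1 hmin _ hmem
        rw [quadForm_smul] at h
        calc quadForm M v0 * ‖v‖ ^ 2 ≤ (‖v‖⁻¹ ^ 2 * quadForm M v) * ‖v‖ ^ 2 := by gcongr
          _ = quadForm M v := by field_simp

variable [DecidableEq κ]

/-- Completion of squares: one step of the Riccati recursion splits the cost-to-go into its optimal
value and the excess caused by deviating from the optimal feedback. -/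
theorem quadForm_completion (A : Matrix ι ι ℝ) (B : Matrix ι κ ℝ) (Q M : Matrix ι ι ℝ)
    (R : Matrix κ κ ℝ) (hM : M.IsSymm) (hR : (Bᵀ * M * B + R).PosDef) (x : ι → ℝ) (u : κ → ℝ) :
    quadForm Q x + quadForm R u + quadForm M (A *ᵥ x + B *ᵥ u) =
      quadForm (Aᵀ * M * A - Aᵀ * M * B * (Bᵀ * M * B + R)⁻¹ * Bᵀ * M * A + Q) x
        + quadForm (Bᵀ * M * B + R) (u - (-((Bᵀ * M * B + R)⁻¹ * Bᵀ * M * A)) *ᵥ x) := by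
  set S := Bᵀ * M * B + R with hS
  have hSs : Sᵀ = S := isSymm_of_isHermitian hR.isHermitian
  have hMs : Mᵀ = M := hM
  have hunit : IsUnit S.det := (isUnit_iff_isUnit_det S).1 hR.isUnit
  -- `-S⁻¹ c` is the minimizing action for the state `x`
  set c : κ → ℝ := Bᵀ *ᵥ (M *ᵥ (A *ᵥ x)) with hc
  have e1 : u - (-(S⁻¹ * Bᵀ * M * A)) *ᵥ x = u + S⁻¹ *ᵥ c := by
    simp only [neg_mulVec, sub_neg_eq_add, hc, mulVec_mulVec, Matrix.mul_assoc]
  have e2 : S *ᵥ (S⁻¹ *ᵥ c) = c := by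
    rw [mulVec_mulVec, mul_nonsing_inv _ hunit, one_mulVec]
  have e3 : (S⁻¹ *ᵥ c) ⬝ᵥ (S *ᵥ u) = c ⬝ᵥ u := by
    rw [dotProduct_mulVec_eq_transpose, hSs, e2]
  have e4 : quadForm (Aᵀ * M * B * S⁻¹ * Bᵀ * M * A) x = c ⬝ᵥ (S⁻¹ *ᵥ c) := by
    have : (Aᵀ * M * B * S⁻¹ * Bᵀ * M * A) *ᵥ x = (Aᵀ * M * B) *ᵥ (S⁻¹ *ᵥ c) := by
      simp only [hc, mulVec_mulVec, Matrix.mul_assoc]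
    rw [quadForm, this, dotProduct_mulVec_eq_transpose]
    congr 1
    simp only [hc, transpose_mul, transpose_transpose, hMs, mulVec_mulVec, Matrix.mul_assoc]
  have e5 : (A *ᵥ x) ⬝ᵥ (M *ᵥ (B *ᵥ u)) = c ⬝ᵥ u := by
    rw [mulVec_mulVec, dotProduct_mulVec_eq_transpose, transpose_mul, hMs, hc]
    simp only [mulVec_mulVec, Matrix.mul_assoc]
  have e6 : (B *ᵥ u) ⬝ᵥ (M *ᵥ (A *ᵥ x)) = c ⬝ᵥ u := by
    rw [dotProduct_comm, dotProduct_mulVec_eq_transpose, hc]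
  rw [e1, quadForm_add S, quadForm_add M, quadForm_add_left, quadForm_sub_left, e4, e5, e6,
    quadForm_mulVec M A, quadForm_mulVec M B, e2, e3]
  have e7 : quadForm S u = quadForm (Bᵀ * M * B) u + quadForm R u := by
    rw [hS, quadForm_add_left]
  have e8 : quadForm S (S⁻¹ *ᵥ c) = c ⬝ᵥ (S⁻¹ *ᵥ c) := by
    rw [quadForm, e2, dotProduct_comm]
  rw [e7, e8, dotProduct_comm u c]
  ring

/-- The Riccati iterates are value functions of nonnegative costs: nonnegativity follows from the
completion of squares at the optimal action, where the excess vanishes. -/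
theorem riccati_posSemidef {A : ℕ → Matrix ι ι ℝ} {B : ℕ → Matrix ι κ ℝ} {Q : ℕ → Matrix ι ι ℝ}
    {R : ℕ → Matrix κ κ ℝ} {T : ℕ} (hQ : ∀ t < T, (Q t).PosSemidef) (hR : ∀ t < T, (R t).PosDef)
    {t : ℕ} (ht : t ≤ T) : (riccati A B Q R T t).PosSemidef := by
  induction ht using Nat.decreasingInduction with
  | self =>
    rw [riccati_terminal]
    exact PosSemidef.zero
  | of_succ t ht ih =>
    have hM : (riccati A B Q R T (t + 1))ᵀ = riccati A B Q R T (t + 1) :=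
      isSymm_of_isHermitian ih.isHermitian
    have hS := posDef_control_weight (B := B t) ih (hR t ht)
    have hSs : ((B t)ᵀ * riccati A B Q R T (t + 1) * B t + R t)ᵀ = _ :=
      isSymm_of_isHermitian hS.isHermitian
    have hQs : (Q t)ᵀ = Q t := isSymm_of_isHermitian (hQ t ht).isHermitian
    refine posSemidef_of_quadForm_nonneg ?_ fun x => ?_
    · rw [riccati_step A B Q R T t ht, IsSymm]
      simp only [transpose_add, transpose_sub, transpose_mul, transpose_transpose, hM, hQs,
        transpose_nonsing_inv]
      rw [transpose_add] at hSs
      simp only [transpose_mul, transpose_transpose, hM] at hSs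
      rw [hSs]
      simp only [Matrix.mul_assoc]
    · have h := quadForm_completion (A t) (B t) (Q t) _ (R t) hM hS x
        ((-(((B t)ᵀ * riccati A B Q R T (t + 1) * B t + R t)⁻¹ * (B t)ᵀ
          * riccati A B Q R T (t + 1) * A t)) *ᵥ x)
      rw [sub_self, quadForm_zero, add_zero, ← riccati_step A B Q R T t ht] at h
      rw [← h]
      have h1 := quadForm_nonneg (hQ t ht) x
      have h2 := fun v => quadForm_nonneg (hR t ht).posSemidef v
      have h3 := fun v => quadForm_nonneg ih v
      exact add_nonneg (add_nonneg h1 (h2 _)) (h3 _)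

/-- The weight `BᵀM_{t+1}B + R` of the excess control in the completion of squares. -/
noncomputable def controlWeight (A : ℕ → Matrix ι ι ℝ) (B : ℕ → Matrix ι κ ℝ)
    (Q : ℕ → Matrix ι ι ℝ) (R : ℕ → Matrix κ κ ℝ) (T t : ℕ) : Matrix κ κ ℝ :=
  (B t)ᵀ * riccati A B Q R T (t + 1) * B t + R t

theorem riccati_completion {A : ℕ → Matrix ι ι ℝ} {B : ℕ → Matrix ι κ ℝ} {Q : ℕ → Matrix ι ι ℝ}
    {R : ℕ → Matrix κ κ ℝ} {T : ℕ} (hQ : ∀ t < T, (Q t).PosSemidef) (hR : ∀ t < T, (R t).PosDef)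
    {t : ℕ} (ht : t < T) (x : ι → ℝ) (u : κ → ℝ) :
    quadForm (Q t) x + quadForm (R t) u
        + quadForm (riccati A B Q R T (t + 1)) (A t *ᵥ x + B t *ᵥ u) =
      quadForm (riccati A B Q R T t) x
        + quadForm (controlWeight A B Q R T t) (u - gain A B Q R T t *ᵥ x) := by
  have hM := riccati_posSemidef (A := A) (B := B) hQ hR (t := t + 1) ht
  rw [riccati_step A B Q R T t ht]
  exact quadForm_completion (A t) (B t) (Q t) _ (R t) (isSymm_of_isHermitian hM.isHermitian)
    (posDef_control_weight hM (hR t ht)) x u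

theorem controlWeight_posSemidef {A : ℕ → Matrix ι ι ℝ} {B : ℕ → Matrix ι κ ℝ}
    {Q : ℕ → Matrix ι ι ℝ} {R : ℕ → Matrix κ κ ℝ} {T : ℕ} (hQ : ∀ t < T, (Q t).PosSemidef)
    (hR : ∀ t < T, (R t).PosDef) {t : ℕ} (ht : t < T) :
    (controlWeight A B Q R T t).PosSemidef :=
  (posDef_control_weight (riccati_posSemidef hQ hR (t := t + 1) ht) (hR t ht)).posSemidef

end QuadraticForms

/-! ### Mean-field coordinates and the dynamic programming identity -/

section MeanFieldCoordinates

variable {d n : ℕ}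

/-- The deviation of follower `i` from the mean-field. -/
noncomputable def dev (x : Agent n → Fin d → ℝ) (i : Fin n) : Fin d → ℝ :=
  x (some i) - avg x

/-- The leader's component stacked on the mean-field. -/
noncomputable def leaderMean (x : Agent n → Fin d → ℝ) : Fin d ⊕ Fin d → ℝ :=
  Sum.elim (x none) (avg x)

theorem avg_add (x y : Agent n → Fin d → ℝ) : avg (x + y) = avg x + avg y := by
  simp [avg, Finset.sum_add_distrib]

theorem avg_smul (c : ℝ) (x : Agent n → Fin d → ℝ) : avg (c • x) = c • avg x := by
  simp only [avg, Pi.smul_apply, ← Finset.smul_sum]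
  rw [smul_comm]

theorem dev_add (x y : Agent n → Fin d → ℝ) (i : Fin n) : dev (x + y) i = dev x i + dev y i := by
  simp only [dev, avg_add, Pi.add_apply]
  abel

theorem dev_smul (c : ℝ) (x : Agent n → Fin d → ℝ) (i : Fin n) :
    dev (c • x) i = c • dev x i := by
  simp only [dev, avg_smul, Pi.smul_apply, smul_sub]

theorem sumElim_add {α β : Type*} (a a' : α → ℝ) (b b' : β → ℝ) :
    Sum.elim (a + a') (b + b') = Sum.elim a b + Sum.elim a' b' := by
  ext k
  cases k <;> rfl

theorem leaderMean_add (x y : Agent n → Fin d → ℝ) :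
    leaderMean (x + y) = leaderMean x + leaderMean y := by
  simp only [leaderMean, avg_add, Pi.add_apply, sumElim_add]

theorem leaderMean_smul (c : ℝ) (x : Agent n → Fin d → ℝ) :
    leaderMean (c • x) = c • leaderMean x := by
  ext k
  cases k <;> simp [leaderMean, avg_smul]

theorem smul_avg (hn : n ≠ 0) (x : Agent n → Fin d → ℝ) :
    (n : ℝ) • avg x = ∑ i, x (some i) := by
  rw [avg, smul_smul, mul_inv_cancel₀ (by exact_mod_cast hn), one_smul]

theorem sum_dev (hn : n ≠ 0) (x : Agent n → Fin d → ℝ) : ∑ i, dev x i = 0 := by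
  simp only [dev, Finset.sum_sub_distrib, Finset.sum_const, Finset.card_univ, Fintype.card_fin]
  rw [← Nat.cast_smul_eq_nsmul ℝ, smul_avg hn, sub_self]

/-- A bilinear form in the joint vectors that separates into the followers' deviations and the pair
formed by the leader and the mean-field. -/
noncomputable def meanFieldForm (n : ℕ) (M : Matrix (Fin d) (Fin d) ℝ)
    (N : Matrix (Fin d ⊕ Fin d) (Fin d ⊕ Fin d) ℝ) :
    (Agent n → Fin d → ℝ) →ₗ[ℝ] (Agent n → Fin d → ℝ) →ₗ[ℝ] ℝ :=
  LinearMap.mk₂ ℝ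
    (fun x y => 1 / (n : ℝ) * ∑ i, dev x i ⬝ᵥ (M *ᵥ dev y i) + leaderMean x ⬝ᵥ (N *ᵥ leaderMean y))
    (fun x x' y => by
      simp only [dev_add, leaderMean_add, add_dotProduct, Finset.sum_add_distrib]
      ring)
    (fun c x y => by
      simp only [dev_smul, leaderMean_smul, smul_dotProduct, smul_eq_mul, ← Finset.mul_sum]
      ring)
    (fun x y y' => by
      simp only [dev_add, leaderMean_add, mulVec_add, dotProduct_add, Finset.sum_add_distrib]
      ring)
    (fun c x y => by
      simp only [dev_smul, leaderMean_smul, mulVec_smul, dotProduct_smul, smul_eq_mul,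
        ← Finset.mul_sum]
      ring)

theorem meanFieldForm_self (M : Matrix (Fin d) (Fin d) ℝ)
    (N : Matrix (Fin d ⊕ Fin d) (Fin d ⊕ Fin d) ℝ) (x : Agent n → Fin d → ℝ) :
    meanFieldForm n M N x x
      = 1 / (n : ℝ) * ∑ i, quadForm M (dev x i) + quadForm N (leaderMean x) := rfl

theorem sum_quadForm_add_const {ι : Type*} [Fintype ι] (M : Matrix ι ι ℝ) (y : Fin n → ι → ℝ)
    (hy : ∑ i, y i = 0) (c : ι → ℝ) :
    ∑ i, quadForm M (y i + c) = ∑ i, quadForm M (y i) + n * quadForm M c := by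
  simp only [quadForm_add, Finset.sum_add_distrib]
  have h1 : ∑ i, y i ⬝ᵥ (M *ᵥ c) = 0 := by
    rw [← sum_dotProduct, hy, zero_dotProduct]
  have h2 : ∑ i, c ⬝ᵥ (M *ᵥ y i) = 0 := by
    rw [← dotProduct_sum, ← mulVec_sum, hy, mulVec_zero, dotProduct_zero]
  rw [h1, h2]
  simp

/-- The mean of a quadratic form splits into its mean over the deviations and its value at the
mean-field, by the orthogonality of the deviations to constants. -/
theorem sum_quadForm_sub (hn : n ≠ 0) (M : Matrix (Fin d) (Fin d) ℝ) (x : Agent n → Fin d → ℝ)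
    (c : Fin d → ℝ) :
    ∑ i : Fin n, quadForm M (x (some i) - c)
      = ∑ i, quadForm M (dev x i) + n * quadForm M (avg x - c) := by
  rw [← sum_quadForm_add_const M (dev x) (sum_dev hn x)]
  simp [dev]

theorem sum_quadForm (hn : n ≠ 0) (M : Matrix (Fin d) (Fin d) ℝ) (x : Agent n → Fin d → ℝ) :
    ∑ i : Fin n, quadForm M (x (some i))
      = ∑ i, quadForm M (dev x i) + n * quadForm M (avg x) := by
  simpa using sum_quadForm_sub hn M x 0

theorem sum_sum_quadForm_sub (hn : n ≠ 0) (M : Matrix (Fin d) (Fin d) ℝ)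
    (x : Agent n → Fin d → ℝ) :
    ∑ i : Fin n, ∑ j : Fin n, quadForm M (x (some i) - x (some j))
      = 2 * n * ∑ i, quadForm M (dev x i) := by
  have h : ∀ i : Fin n, ∑ j : Fin n, quadForm M (x (some i) - x (some j))
      = ∑ j, quadForm M (dev x j) + n * quadForm M (dev x i) := by
    intro i
    have h1 : ∀ j : Fin n, quadForm M (x (some i) - x (some j))
        = quadForm M (x (some j) - x (some i)) := fun j => by
      rw [← quadForm_neg, neg_sub]
    simp only [h1]
    rw [sum_quadForm_sub hn, ← quadForm_neg M (avg x - x (some i)), neg_sub]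
    rfl
  simp only [h, Finset.sum_add_distrib, ← Finset.mul_sum]
  simp
  ring

theorem quadForm_fromBlocks_diag {κ : Type*} [Fintype κ] (M N : Matrix κ κ ℝ) (a b : κ → ℝ) :
    quadForm (fromBlocks M 0 0 N) (Sum.elim a b) = quadForm M a + quadForm N b := by
  simp [quadForm, fromBlocks_mulVec, sumElim_dotProduct_sumElim]

end MeanFieldCoordinates

namespace LQSystem

variable {dx du : ℕ} (S : LQSystem dx du)

theorem quadForm_Qbar (t : ℕ) (a b : Fin dx → ℝ) :
    quadForm (S.Qbar t) (Sum.elim a b) = quadForm (S.Q0 t) a + quadForm (S.F t) (b - a)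
      + quadForm (S.P t) (b - a) + quadForm (S.Q t) b := by
  simp only [quadForm, Qbar, fromBlocks_mulVec, sumElim_dotProduct_sumElim, Sum.elim_comp_inl,
    Sum.elim_comp_inr, add_mulVec, sub_mulVec, neg_mulVec, mulVec_sub, dotProduct_add,
    dotProduct_sub, dotProduct_neg, sub_dotProduct]
  ring

/-- The stage cost in terms of deviations, mean-field and leader. -/
theorem stageCost_eq {n : ℕ} (hn : n ≠ 0) (t : ℕ) (x : State dx n) (u : Action du n) :
    S.stageCost t x u =
      1 / (n : ℝ) * ∑ i, quadForm (S.Q t + S.P t + S.H t) (dev x i)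
        + quadForm (S.Qbar t) (leaderMean x)
        + (quadForm (S.R0 t) (u none) + 1 / (n : ℝ) * ∑ i, quadForm (S.R t) (u (some i))) := by
  have hn' : (n : ℝ) ≠ 0 := by exact_mod_cast hn
  simp only [stageCost, quad_eq_quadForm, leaderMean, quadForm_Qbar, Finset.sum_add_distrib,
    quadForm_add_left]
  rw [sum_quadForm hn (S.Q t), sum_quadForm_sub hn (S.P t), sum_sum_quadForm_sub hn]
  field_simp
  ring

theorem control_cost_eq {n : ℕ} (hn : n ≠ 0) (t : ℕ) (u : Action du n) :
    quadForm (S.R0 t) (u none) + 1 / (n : ℝ) * ∑ i, quadForm (S.R t) (u (some i)) =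
      1 / (n : ℝ) * ∑ i, quadForm (S.R t) (dev u i) + quadForm (S.Rbar t) (leaderMean u) := by
  have hn' : (n : ℝ) ≠ 0 := by exact_mod_cast hn
  rw [leaderMean, Rbar, quadForm_fromBlocks_diag, sum_quadForm hn]
  field_simp
  ring

theorem avg_step {n : ℕ} (hn : n ≠ 0) (t : ℕ) (x : State dx n) (u : Action du n)
    (w : State dx n) :
    avg (S.step t x u w) =
      (S.A t + S.D t) *ᵥ avg x + S.B t *ᵥ avg u + S.E t *ᵥ x none + avg w := by
  have hn' : (n : ℝ) ≠ 0 := by exact_mod_cast hn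
  have hc : ∀ v : Fin dx → ℝ, (n : ℝ)⁻¹ • (n • v) = v := fun v => by
    rw [← Nat.cast_smul_eq_nsmul ℝ, smul_smul, inv_mul_cancel₀ hn', one_smul]
  rw [avg]
  simp only [step, Finset.sum_add_distrib, ← mulVec_sum, smul_add, ← mulVec_smul, Finset.sum_const,
    Finset.card_univ, Fintype.card_fin, hc, add_mulVec]
  simp only [avg]
  abel

theorem dev_step {n : ℕ} (hn : n ≠ 0) (t : ℕ) (x : State dx n) (u : Action du n)
    (w : State dx n) (i : Fin n) :
    dev (S.step t x u w) i = S.A t *ᵥ dev x i + S.B t *ᵥ dev u i + dev w i := by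
  rw [dev, avg_step S hn]
  simp only [dev, step, mulVec_sub, add_mulVec]
  abel

theorem leaderMean_step {n : ℕ} (hn : n ≠ 0) (t : ℕ) (x : State dx n) (u : Action du n)
    (w : State dx n) :
    leaderMean (S.step t x u w) =
      S.Abar t *ᵥ leaderMean x + S.Bbar t *ᵥ leaderMean u + leaderMean w := by
  simp only [leaderMean, avg_step S hn, Abar, Bbar, fromBlocks_mulVec, Sum.elim_comp_inl,
    Sum.elim_comp_inr, ← sumElim_add, zero_mulVec, add_zero, zero_add]
  congr 1
  · simp only [step]
    abel
  · abel

theorem step_eq_add {n : ℕ} (t : ℕ) (x : State dx n) (u : Action du n) (w : State dx n) :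
    S.step t x u w = S.step t x u 0 + w := by
  ext a : 1
  cases a <;> simp [step]

/-- The bilinear form whose diagonal `x ↦ valueForm n T t x x` is the noiseless value function at
time `t`. -/
noncomputable def valueForm (n T t : ℕ) : State dx n →ₗ[ℝ] State dx n →ₗ[ℝ] ℝ :=
  meanFieldForm n (riccati S.A S.B (fun s => S.Q s + S.P s + S.H s) S.R T t)
    (riccati S.Abar S.Bbar S.Qbar S.Rbar T t)

/-- The excess cost caused at time `t` by an action that differs from the optimal feedback. -/
noncomputable def excess {n : ℕ} (T t : ℕ) (x : State dx n) (u : Action du n) : ℝ :=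
  1 / (n : ℝ) * ∑ i,
      quadForm (controlWeight S.A S.B (fun s => S.Q s + S.P s + S.H s) S.R T t)
        (dev u i - S.Lbreve T t *ᵥ dev x i)
    + quadForm (controlWeight S.Abar S.Bbar S.Qbar S.Rbar T t)
        (leaderMean u - S.Lbar T t *ᵥ leaderMean x)

theorem valueForm_terminal (n T : ℕ) : S.valueForm n T T = 0 := by
  ext x y
  simp [valueForm, riccati_terminal, meanFieldForm]

variable {S}

theorem PositiveWeights.Rbar {T : ℕ} (hpos : S.PositiveWeights T) :
    ∀ t < T, (S.Rbar t).PosDef := by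
  intro t ht
  refine PosDef.of_dotProduct_mulVec_pos ?_ fun v hv => ?_
  · rw [LQSystem.Rbar, isHermitian_fromBlocks_iff]
    exact ⟨(hpos.R0 t ht).isHermitian, by simp, by simp, (hpos.R t ht).isHermitian⟩
  · have h : v = Sum.elim (v ∘ Sum.inl) (v ∘ Sum.inr) := (Sum.elim_comp_inl_inr v).symm
    have h0 := quadForm_nonneg (hpos.R0 t ht).posSemidef (v ∘ Sum.inl)
    have h1 := quadForm_nonneg (hpos.R t ht).posSemidef (v ∘ Sum.inr)
    suffices 0 < quadForm (S.Rbar t) v by simpa [quadForm] using this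
    rw [h, LQSystem.Rbar, quadForm_fromBlocks_diag]
    by_cases hl : v ∘ Sum.inl = 0
    · have hr : v ∘ Sum.inr ≠ 0 := fun hr => hv <| by
        rw [h, hl, hr]
        ext k
        cases k <;> rfl
      have : 0 < quadForm (S.R t) (v ∘ Sum.inr) := by
        simpa [quadForm] using (hpos.R t ht).dotProduct_mulVec_pos hr
      linarith
    · have : 0 < quadForm (S.R0 t) (v ∘ Sum.inl) := by
        simpa [quadForm] using (hpos.R0 t ht).dotProduct_mulVec_pos hl
      linarith

theorem excess_nonneg {n T : ℕ} (hpos : S.PositiveWeights T) {t : ℕ} (ht : t < T)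
    (x : State dx n) (u : Action du n) : 0 ≤ S.excess T t x u := by
  have h1 := controlWeight_posSemidef (A := S.A) (B := S.B) hpos.QPH hpos.R ht
  have h2 := controlWeight_posSemidef (A := S.Abar) (B := S.Bbar) hpos.Qbar hpos.Rbar ht
  exact add_nonneg (mul_nonneg (by positivity)
    (Finset.sum_nonneg fun i _ => quadForm_nonneg h1 _)) (quadForm_nonneg h2 _)

theorem control_cost_le_stageCost {n T : ℕ} (hn : n ≠ 0) (hpos : S.PositiveWeights T) {t : ℕ}
    (ht : t < T) (x : State dx n) (u : Action du n) :
    quadForm (S.R0 t) (u none) + 1 / (n : ℝ) * ∑ i, quadForm (S.R t) (u (some i))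
      ≤ S.stageCost t x u := by
  rw [stageCost_eq S hn]
  have h1 : 0 ≤ 1 / (n : ℝ) * ∑ i, quadForm (S.Q t + S.P t + S.H t) (dev x i) :=
    mul_nonneg (by positivity) (Finset.sum_nonneg fun i _ => quadForm_nonneg (hpos.QPH t ht) _)
  have h2 := quadForm_nonneg (hpos.Qbar t ht) (leaderMean x)
  linarith

theorem stageCost_nonneg {n T : ℕ} (hn : n ≠ 0) (hpos : S.PositiveWeights T) {t : ℕ} (ht : t < T)
    (x : State dx n) (u : Action du n) : 0 ≤ S.stageCost t x u := by
  refine le_trans ?_ (control_cost_le_stageCost hn hpos ht x u)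
  exact add_nonneg (quadForm_nonneg (hpos.R0 t ht).posSemidef _)
    (mul_nonneg (by positivity)
      (Finset.sum_nonneg fun i _ => quadForm_nonneg (hpos.R t ht).posSemidef _))

/-- The stage cost controls every agent's action, by positive definiteness of the control
weights. -/
theorem exists_norm_sq_le_stageCost {n T : ℕ} (hn : n ≠ 0) (hpos : S.PositiveWeights T) {t : ℕ}
    (ht : t < T) : ∃ c : ℝ, 0 < c ∧ ∀ (x : State dx n) (u : Action du n) (a : Agent n),
      c * ‖u a‖ ^ 2 ≤ S.stageCost t x u := by
  obtain ⟨c0, hc0, h0⟩ := exists_le_quadForm (hpos.R0 t ht)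
  obtain ⟨c1, hc1, h1⟩ := exists_le_quadForm (hpos.R t ht)
  have hn' : (0 : ℝ) < n := by exact_mod_cast Nat.pos_of_ne_zero hn
  refine ⟨min c0 (1 / n * c1), lt_min hc0 (by positivity), fun x u a => ?_⟩
  refine le_trans ?_ (control_cost_le_stageCost hn hpos ht x u)
  have hR0 := quadForm_nonneg (hpos.R0 t ht).posSemidef (u none)
  have hR := fun i : Fin n => quadForm_nonneg (hpos.R t ht).posSemidef (u (some i))
  cases a with
  | none =>
    calc min c0 (1 / n * c1) * ‖u none‖ ^ 2 ≤ c0 * ‖u none‖ ^ 2 := by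
          gcongr
          exact min_le_left _ _
      _ ≤ quadForm (S.R0 t) (u none) := h0 _
      _ ≤ _ := le_add_of_nonneg_right
          (mul_nonneg (by positivity) (Finset.sum_nonneg fun i _ => hR i))
  | some j =>
    calc min c0 (1 / n * c1) * ‖u (some j)‖ ^ 2 ≤ (1 / n * c1) * ‖u (some j)‖ ^ 2 := by
          gcongr
          exact min_le_right _ _
      _ = 1 / n * (c1 * ‖u (some j)‖ ^ 2) := by ring
      _ ≤ 1 / n * ∑ i, quadForm (S.R t) (u (some i)) := by
          gcongr
          exact (h1 _).trans (Finset.single_le_sum (f := fun i => quadForm (S.R t) (u (some i)))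
            (fun i _ => hR i) (Finset.mem_univ j))
      _ ≤ _ := le_add_of_nonneg_left hR0

/-- The dynamic programming identity for the noiseless step. -/
theorem stageCost_add_value {n T : ℕ} (hn : n ≠ 0) (hpos : S.PositiveWeights T) {t : ℕ}
    (ht : t < T) (x : State dx n) (u : Action du n) :
    S.stageCost t x u + S.valueForm n T (t + 1) (S.step t x u 0) (S.step t x u 0)
      = S.valueForm n T t x x + S.excess T t x u := by
  have hdev : ∀ i, dev (S.step t x u 0) i = S.A t *ᵥ dev x i + S.B t *ᵥ dev u i := fun i => by
    rw [dev_step S hn]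
    simp [dev, avg]
  have hlm : leaderMean (S.step t x u 0)
      = S.Abar t *ᵥ leaderMean x + S.Bbar t *ᵥ leaderMean u := by
    rw [leaderMean_step S hn, ← zero_smul ℝ (0 : State dx n), leaderMean_smul, zero_smul, add_zero]
  have h1 := fun i => riccati_completion (A := S.A) (B := S.B) hpos.QPH hpos.R ht
    (dev x i) (dev u i)
  have h2 := riccati_completion (A := S.Abar) (B := S.Bbar) hpos.Qbar hpos.Rbar ht
    (leaderMean x) (leaderMean u)
  have h3 := Finset.sum_congr (rfl : (Finset.univ : Finset (Fin n)) = _) fun i _ => h1 i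
  simp only [Finset.sum_add_distrib] at h3
  rw [stageCost_eq S hn, control_cost_eq S hn, valueForm, valueForm, meanFieldForm_self,
    meanFieldForm_self, excess, hlm, Lbreve, Lbar]
  simp only [hdev]
  linear_combination 1 / (n : ℝ) * h3 + h2

end LQSystem

/-! ### Square integrability, information structures and independence of the noise -/

section SquareIntegrable

variable {Ω : Type*} [MeasurableSpace Ω] {μ : Measure Ω}
  {E F G : Type*} [NormedAddCommGroup E] [NormedSpace ℝ E] [FiniteDimensional ℝ E]
  [NormedAddCommGroup F] [NormedSpace ℝ F] [FiniteDimensional ℝ F]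
  [NormedAddCommGroup G] [NormedSpace ℝ G]

theorem memLp_linearMap_comp (L : E →ₗ[ℝ] G) {X : Ω → E} (hX : MemLp X 2 μ) :
    MemLp (fun ω => L (X ω)) 2 μ :=
  L.toContinuousLinearMap.comp_memLp' hX

theorem integrable_bilinear (L : E →ₗ[ℝ] F →ₗ[ℝ] ℝ) {X : Ω → E} {Y : Ω → F} (hX : MemLp X 2 μ)
    (hY : MemLp Y 2 μ) : Integrable (fun ω => L (X ω) (Y ω)) μ :=
  memLp_one_iff_integrable.1 (L.toContinuousBilinearMap.memLp_of_bilin 1 hX hY)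

theorem integrable_quadForm {ι : Type*} [Fintype ι] (M : Matrix ι ι ℝ) {v : Ω → ι → ℝ}
    (hv : MemLp v 2 μ) : Integrable (fun ω => quadForm M (v ω)) μ := by
  classical
  simpa [quadForm, Matrix.toLinearMap₂'_apply'] using
    integrable_bilinear (Matrix.toLinearMap₂' ℝ M) hv hv

/-- Adding an independent centered vector to `X` changes the mean of a quadratic form by the mean
of the form at that vector only. -/
theorem integral_bilinear_add_of_indepFun [IsProbabilityMeasure μ] [MeasurableSpace E]
    [BorelSpace E] (L : E →ₗ[ℝ] E →ₗ[ℝ] ℝ) {X W : Ω → E} (hX : MemLp X 2 μ) (hW : MemLp W 2 μ)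
    (hXW : IndepFun X W μ) (h0 : ∫ ω, W ω ∂μ = 0) :
    ∫ ω, L (X ω + W ω) (X ω + W ω) ∂μ = ∫ ω, L (X ω) (X ω) ∂μ + ∫ ω, L (W ω) (W ω) ∂μ := by
  have := FiniteDimensional.complete ℝ E
  have hX1 : Integrable X μ := hX.integrable (by norm_num)
  have hW1 : Integrable W μ := hW.integrable (by norm_num)
  have e1 : ∫ ω, L (X ω) (W ω) ∂μ = 0 := by
    have h := hXW.integral_bilin hX1 hW1 L.toContinuousBilinearMap
    simpa [h0] using h
  have e2 : ∫ ω, L (W ω) (X ω) ∂μ = 0 := by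
    have h := hXW.symm.integral_bilin hW1 hX1 L.toContinuousBilinearMap
    simpa [h0] using h
  have iXX := integrable_bilinear L hX hX
  have iWW := integrable_bilinear L hW hW
  have iXW := integrable_bilinear L hX hW
  have iWX := integrable_bilinear L hW hX
  have hexp : ∀ ω, L (X ω + W ω) (X ω + W ω)
      = (L (X ω) (X ω) + L (W ω) (W ω)) + (L (X ω) (W ω) + L (W ω) (X ω)) := fun ω => by
    simp only [map_add, LinearMap.add_apply]
    ring
  simp only [hexp]
  rw [integral_add, integral_add iXX iWW, integral_add iXW iWX, e1, e2]
  · ring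
  · exact iXX.add iWW
  · exact iXW.add iWX

/-- For a nonnegative variable the extended expectation is a Lebesgue integral, so the convention
`⊤ - ⊤ = ⊥` in `EReal` plays no role. -/
theorem extExpectation_of_nonneg {f : Ω → ℝ} (hf : ∀ ω, 0 ≤ f ω) :
    extExpectation μ f = ((∫⁻ ω, ENNReal.ofReal (f ω) ∂μ : ℝ≥0∞) : EReal) := by
  have h : ∀ ω, ENNReal.ofReal (-f ω) = 0 := fun ω => ENNReal.ofReal_of_nonpos (by linarith [hf ω])
  simp [extExpectation, h]

theorem extExpectation_eq_integral {f : Ω → ℝ} (hf : ∀ ω, 0 ≤ f ω) (hi : Integrable f μ) :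
    extExpectation μ f = ((∫ ω, f ω ∂μ : ℝ) : EReal) := by
  rw [extExpectation_of_nonneg hf,
    ← ofReal_integral_eq_lintegral_ofReal hi (Eventually.of_forall hf), EReal.coe_ennreal_ofReal,
    max_eq_left (integral_nonneg hf)]

end SquareIntegrable

section Information

variable {dx du n : ℕ} {g : Strategy dx du n}

theorem measurable_avg {d : ℕ} : Measurable (avg : (Agent n → Fin d → ℝ) → Fin d → ℝ) := by
  unfold avg
  fun_prop

theorem IsMeanFieldSharing.measurable (hg : IsMeanFieldSharing g) (t : ℕ) : Measurable (g t) := by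
  have hav : ∀ s : Fin (t + 1), Measurable fun h : Fin (t + 1) → State dx n => avg (h s) :=
    fun s => measurable_avg.comp (measurable_pi_apply s)
  refine measurable_pi_iff.2 fun a => ?_
  cases a with
  | none =>
    obtain ⟨φ, hφ, h⟩ := hg.1 t
    simp only [h]
    exact hφ.comp (by fun_prop)
  | some i =>
    obtain ⟨φ, hφ, h⟩ := hg.2 i t
    simp only [h]
    exact hφ.comp (by fun_prop)

theorem IsDecentralized.isMeanFieldSharing (hg : IsDecentralized g) : IsMeanFieldSharing g := by
  refine ⟨fun t => ?_, fun i t => ?_⟩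
  · obtain ⟨φ, hφ, h⟩ := hg.1 t
    exact ⟨fun p => φ p.1, hφ.comp measurable_fst, h⟩
  · obtain ⟨φ, hφ, h⟩ := hg.2 i t
    exact ⟨fun p => φ (p.1, p.2.1), hφ.comp (by fun_prop), h⟩

end Information

namespace LQSystem

variable {dx du : ℕ} (S : LQSystem dx du) {n : ℕ}

theorem state_zero (g : Strategy dx du n) (x1 : State dx n) (w : ℕ → State dx n) :
    S.state g x1 w 0 = x1 := rfl

theorem state_succ (g : Strategy dx du n) (x1 : State dx n) (w : ℕ → State dx n) (t : ℕ) :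
    S.state g x1 w (t + 1) = S.step t (S.state g x1 w t) (S.action g x1 w t) (w t) := by
  simp [state, history, action]

theorem history_apply (g : Strategy dx du n) (x1 : State dx n) (w : ℕ → State dx n) (t : ℕ)
    (i : Fin (t + 1)) : S.history g x1 w t i = S.state g x1 w i := by
  induction t with
  | zero =>
    obtain rfl : i = 0 := Fin.fin_one_eq_zero i
    rfl
  | succ t ih =>
    induction i using Fin.lastCases with
    | last => rfl
    | cast i => simpa [history] using ih i

/-- The noiseless step as a linear map. -/
noncomputable def stepLinear (n t : ℕ) : (State dx n × Action du n) →ₗ[ℝ] State dx n where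
  toFun p := S.step t p.1 p.2 0
  map_add' p q := by
    ext a : 1
    cases a <;> simp only [step, Prod.fst_add, Prod.snd_add, Pi.add_apply, avg_add, mulVec_add,
      Pi.zero_apply] <;> abel
  map_smul' c p := by
    ext a : 1
    cases a <;> simp [step, avg_smul, mulVec_smul]

theorem stepLinear_apply (t : ℕ) (x : State dx n) (u : Action du n) :
    S.stepLinear n t (x, u) = S.step t x u 0 := rfl

theorem measurable_stepLinear (n t : ℕ) : Measurable (S.stepLinear n t) :=
  (S.stepLinear n t).continuous_of_finiteDimensional.measurable

theorem step_eq_stepLinear_add (t : ℕ) (x : State dx n) (u : Action du n) (w : State dx n) :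
    S.step t x u w = S.stepLinear n t (x, u) + w :=
  S.step_eq_add t x u w

theorem memLp_stepLinear {Ω : Type*} [MeasurableSpace Ω] {μ : Measure Ω} (t : ℕ)
    {x : Ω → State dx n} {u : Ω → Action du n} (hx : MemLp x 2 μ) (hu : MemLp u 2 μ) :
    MemLp (fun ω => S.stepLinear n t (x ω, u ω)) 2 μ := by
  refine ((memLp_linearMap_comp (S.stepLinear n t ∘ₗ LinearMap.inl ℝ _ _) hx).add
    (memLp_linearMap_comp (S.stepLinear n t ∘ₗ LinearMap.inr ℝ _ _) hu)).ae_eq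
    (Eventually.of_forall fun ω => ?_)
  simp only [Pi.add_apply, LinearMap.comp_apply, LinearMap.inl_apply, LinearMap.inr_apply,
    ← map_add, Prod.mk_add_mk, add_zero, zero_add]

theorem measurable_history {Ω : Type*} [mΩ : MeasurableSpace Ω] {g : Strategy dx du n}
    (hg : ∀ t, Measurable (g t)) {x1 : Ω → State dx n} {w : ℕ → Ω → State dx n}
    (hx : Measurable x1) {t : ℕ} (hw : ∀ s < t, Measurable (w s)) :
    Measurable fun ω => S.history g (x1 ω) (fun s => w s ω) t := by
  induction t with
  | zero => exact measurable_pi_iff.2 fun _ => hx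
  | succ t ih =>
    have ih' := ih fun s hs => hw s (by omega)
    refine measurable_pi_iff.2 fun i => ?_
    induction i using Fin.lastCases with
    | last =>
      simp only [history, Fin.snoc_last, step_eq_stepLinear_add]
      refine Measurable.add ((S.measurable_stepLinear n t).comp ?_) (hw t (by omega))
      exact ((measurable_pi_apply _).comp ih').prodMk ((hg t).comp ih')
    | cast i =>
      simp only [history, Fin.snoc_castSucc]
      exact (measurable_pi_apply i).comp ih'

section Random

variable {Ω : Type*} (g : Strategy dx du n)
  (init : Agent n → Ω → Fin dx → ℝ) (noise : ℕ → Agent n → Ω → Fin dx → ℝ)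

/-- The joint state at time `t` as a random vector. -/
noncomputable def randomState (t : ℕ) (ω : Ω) : State dx n :=
  S.state g (fun a => init a ω) (fun s a => noise s a ω) t

/-- The joint action at time `t` as a random vector. -/
noncomputable def randomAction (t : ℕ) (ω : Ω) : Action du n :=
  S.action g (fun a => init a ω) (fun s a => noise s a ω) t

theorem randomState_succ (t : ℕ) (ω : Ω) :
    S.randomState g init noise (t + 1) ω
      = S.stepLinear n t (S.randomState g init noise t ω, S.randomAction g init noise t ω)
        + fun a => noise t a ω := by
  rw [randomState, state_succ, step_eq_stepLinear_add]
  rfl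

end Random

end LQSystem

namespace PrimitiveAssumptions

variable {dx du n T : ℕ} {S : LQSystem dx du} {Ω : Type*} [MeasurableSpace Ω] {μ : Measure Ω}
  {init : Agent n → Ω → Fin dx → ℝ} {noise : ℕ → Agent n → Ω → Fin dx → ℝ} {m : Fin dx → ℝ}
  {covX covW : Matrix (Fin dx) (Fin dx) ℝ} {g : Strategy dx du n}

theorem measurable_primitives (hA : PrimitiveAssumptions T μ init noise m covX covW) (i) :
    Measurable (primitives T init noise i) := by
  rcases i with a | ⟨t, a⟩
  · exact hA.measurable_init a
  · exact hA.measurable_noise t t.2 a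

theorem measurable_jointNoise (hA : PrimitiveAssumptions T μ init noise m covX covW) {t : ℕ}
    (ht : t < T) : Measurable fun ω a => noise t a ω :=
  measurable_pi_iff.2 fun a => hA.measurable_noise t ht a

theorem measurable_history (hA : PrimitiveAssumptions T μ init noise m covX covW)
    (hg : ∀ t, Measurable (g t)) {t : ℕ} (ht : t ≤ T) :
    Measurable fun ω => S.history g (fun a => init a ω) (fun s a => noise s a ω) t :=
  S.measurable_history hg (measurable_pi_iff.2 hA.measurable_init)
    fun s hs => hA.measurable_jointNoise (by omega)

theorem measurable_action (hA : PrimitiveAssumptions T μ init noise m covX covW)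
    (hg : ∀ t, Measurable (g t)) {t : ℕ} (ht : t ≤ T) :
    Measurable (S.randomAction g init noise t) :=
  (hg t).comp (hA.measurable_history hg ht)

/-- The noise at time `t` is independent of the history up to time `t`, which is a function of the
initial states and of the earlier noises. -/
theorem indepFun_history_noise (hA : PrimitiveAssumptions T μ init noise m covX covW)
    (hg : ∀ t, Measurable (g t)) {t : ℕ} (ht : t < T) :
    IndepFun (fun ω => S.history g (fun a => init a ω) (fun s a => noise s a ω) t)
      (fun ω a => noise t a ω) μ := by
  set past : Set (Agent n ⊕ (Fin T × Agent n)) :=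
    {i | ∀ s a, i = Sum.inr (s, a) → (s : ℕ) < t} with hpast
  set now : Set (Agent n ⊕ (Fin T × Agent n)) := {i | ∃ a, i = Sum.inr (⟨t, ht⟩, a)} with hnow
  set σ : Agent n ⊕ (Fin T × Agent n) → MeasurableSpace Ω :=
    fun i => MeasurableSpace.comap (primitives T init noise i) inferInstance with hσ
  have hdisj : Disjoint past now := by
    rw [Set.disjoint_left]
    rintro i hi ⟨a, rfl⟩
    exact lt_irrefl t (hi _ _ rfl)
  have hind := indep_iSup_of_disjoint (m := σ) (fun i => (hA.measurable_primitives i).comap_le)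
    hA.indep hdisj
  have hmeas : ∀ {A : Set (Agent n ⊕ (Fin T × Agent n))} {i}, i ∈ A →
      Measurable[⨆ j ∈ A, σ j] (primitives T init noise i) := fun {A i} hi =>
    (comap_measurable (primitives T init noise i)).mono (le_biSup σ hi) le_rfl
  rw [IndepFun_iff_Indep]
  refine indep_of_indep_of_le_left (indep_of_indep_of_le_right hind ?_) ?_
  · refine Measurable.comap_le ?_
    refine (@measurable_pi_iff _ _ _ (⨆ j ∈ now, σ j) _ _).2 fun a => ?_
    exact hmeas (A := now) (i := Sum.inr (⟨t, ht⟩, a)) ⟨a, rfl⟩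
  · refine Measurable.comap_le ?_
    refine S.measurable_history (mΩ := ⨆ j ∈ past, σ j) hg
      ((@measurable_pi_iff _ _ _ (⨆ j ∈ past, σ j) _ _).2 fun a => ?_)
      fun s hs => (@measurable_pi_iff _ _ _ (⨆ j ∈ past, σ j) _ _).2 fun a => ?_
    · exact hmeas (A := past) (i := Sum.inl a) (by simp [hpast])
    · refine hmeas (A := past) (i := Sum.inr (⟨s, hs.trans ht⟩, a)) ?_
      intro s' a' h
      simp only [Sum.inr.injEq, Prod.mk.injEq] at h
      rw [← h.1]
      exact hs

theorem memLp_jointInit (hA : PrimitiveAssumptions T μ init noise m covX covW) :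
    MemLp (fun ω a => init a ω) 2 μ :=
  MemLp.of_eval hA.memLp_init

theorem memLp_jointNoise (hA : PrimitiveAssumptions T μ init noise m covX covW) {t : ℕ}
    (ht : t < T) : MemLp (fun ω a => noise t a ω) 2 μ :=
  MemLp.of_eval (hA.memLp_noise t ht)

theorem integral_jointNoise [IsProbabilityMeasure μ]
    (hA : PrimitiveAssumptions T μ init noise m covX covW) {t : ℕ} (ht : t < T) :
    ∫ ω, (fun a => noise t a ω) ∂μ = 0 := by
  have hi := (hA.memLp_jointNoise ht).integrable (q := 2) (by norm_num)
  ext a k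
  rw [eval_integral (fun a => hi.eval a), eval_integral (fun k => (hi.eval a).eval k)]
  exact hA.noise_mean t ht a k

theorem memLp_state_succ (hA : PrimitiveAssumptions T μ init noise m covX covW) {t : ℕ}
    (ht : t < T) (hx : MemLp (S.randomState g init noise t) 2 μ)
    (hu : MemLp (S.randomAction g init noise t) 2 μ) :
    MemLp (S.randomState g init noise (t + 1)) 2 μ := by
  have h := (S.memLp_stepLinear t hx hu).add (hA.memLp_jointNoise ht)
  exact h.ae_eq (Eventually.of_forall fun ω => (S.randomState_succ g init noise t ω).symm)

end PrimitiveAssumptions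

/-! ### The cost as an uncontrollable part plus the expected excess -/

section SquareIntegrableCoordinates

variable {Ω : Type*} [MeasurableSpace Ω] {μ : Measure Ω} {d n : ℕ} {x : Ω → Agent n → Fin d → ℝ}

theorem memLp_mulVec {ι κ : Type*} [Fintype ι] [Fintype κ] (M : Matrix ι κ ℝ) {v : Ω → κ → ℝ}
    (hv : MemLp v 2 μ) : MemLp (fun ω => M *ᵥ v ω) 2 μ :=
  memLp_linearMap_comp M.mulVecLin hv

theorem memLp_avg (hx : MemLp x 2 μ) : MemLp (fun ω => avg (x ω)) 2 μ :=
  (memLp_finsetSum Finset.univ fun (i : Fin n) _ => hx.eval (some i)).const_smul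
    (n : ℝ)⁻¹

theorem memLp_dev (hx : MemLp x 2 μ) (i : Fin n) : MemLp (fun ω => dev (x ω) i) 2 μ :=
  (hx.eval (some i)).sub (memLp_avg hx)

theorem memLp_leaderMean (hx : MemLp x 2 μ) : MemLp (fun ω => leaderMean (x ω)) 2 μ := by
  refine MemLp.of_eval fun k => ?_
  cases k with
  | inl k => exact (hx.eval none).eval k
  | inr k => exact (memLp_avg hx).eval k

end SquareIntegrableCoordinates

namespace LQSystem

variable {dx du n T : ℕ} {S : LQSystem dx du} {Ω : Type*} [MeasurableSpace Ω] {μ : Measure Ω}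

theorem integrable_stageCost (hn : n ≠ 0) (t : ℕ) {x : Ω → State dx n} {u : Ω → Action du n}
    (hx : MemLp x 2 μ) (hu : MemLp u 2 μ) :
    Integrable (fun ω => S.stageCost t (x ω) (u ω)) μ := by
  simp only [stageCost_eq S hn]
  refine (((integrable_finsetSum _ fun i _ => ?_).const_mul _).add ?_).add
    (Integrable.add ?_ ((integrable_finsetSum _ fun i _ => ?_).const_mul _))
  · exact integrable_quadForm _ (memLp_dev hx i)
  · exact integrable_quadForm _ (memLp_leaderMean hx)
  · exact integrable_quadForm _ (hu.eval none)
  · exact integrable_quadForm _ (hu.eval (some i))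

theorem integrable_excess (T t : ℕ) {x : Ω → State dx n} {u : Ω → Action du n}
    (hx : MemLp x 2 μ) (hu : MemLp u 2 μ) :
    Integrable (fun ω => S.excess T t (x ω) (u ω)) μ := by
  refine ((integrable_finsetSum _ fun i _ => ?_).const_mul _).add ?_
  · exact integrable_quadForm _ ((memLp_dev hu i).sub (memLp_mulVec _ (memLp_dev hx i)))
  · exact integrable_quadForm _ ((memLp_leaderMean hu).sub (memLp_mulVec _ (memLp_leaderMean hx)))

variable (S) in
/-- The part of the cost that no strategy can influence: the value of the initial states plus the
values of the noises. -/
noncomputable def baseCost (T : ℕ) (μ : Measure Ω) (init : Agent n → Ω → Fin dx → ℝ)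
    (noise : ℕ → Agent n → Ω → Fin dx → ℝ) : ℝ :=
  ∫ ω, S.valueForm n T 0 (fun a => init a ω) (fun a => init a ω) ∂μ
    + ∑ t ∈ Finset.range T,
        ∫ ω, S.valueForm n T (t + 1) (fun a => noise t a ω) (fun a => noise t a ω) ∂μ

variable [IsProbabilityMeasure μ] {init : Agent n → Ω → Fin dx → ℝ}
  {noise : ℕ → Agent n → Ω → Fin dx → ℝ} {m : Fin dx → ℝ} {covX covW : Matrix (Fin dx) (Fin dx) ℝ}
  {g : Strategy dx du n}

omit [IsProbabilityMeasure μ] in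
theorem memLp_state (hA : PrimitiveAssumptions T μ init noise m covX covW) {t : ℕ} (ht : t ≤ T)
    (hu : ∀ s < t, MemLp (S.randomAction g init noise s) 2 μ) :
    MemLp (S.randomState g init noise t) 2 μ := by
  induction t with
  | zero => exact hA.memLp_jointInit
  | succ t ih =>
    exact hA.memLp_state_succ ht (ih (by omega) fun s hs => hu s (by omega)) (hu t (by omega))

/-- The dynamic programming identity in expectation. -/
theorem integral_stageCost_add_value (hn : n ≠ 0) (hpos : S.PositiveWeights T)
    (hA : PrimitiveAssumptions T μ init noise m covX covW) (hg : ∀ t, Measurable (g t)) {t : ℕ}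
    (ht : t < T) (hx : MemLp (S.randomState g init noise t) 2 μ)
    (hu : MemLp (S.randomAction g init noise t) 2 μ) :
    ∫ ω, S.stageCost t (S.randomState g init noise t ω) (S.randomAction g init noise t ω) ∂μ
        + ∫ ω, S.valueForm n T (t + 1) (S.randomState g init noise (t + 1) ω)
            (S.randomState g init noise (t + 1) ω) ∂μ
      = ∫ ω, S.valueForm n T t (S.randomState g init noise t ω)
            (S.randomState g init noise t ω) ∂μ
        + ∫ ω, S.excess T t (S.randomState g init noise t ω)
            (S.randomAction g init noise t ω) ∂μ
        + ∫ ω, S.valueForm n T (t + 1) (fun a => noise t a ω) (fun a => noise t a ω) ∂μ := by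
  have hf := S.memLp_stepLinear t hx hu
  have hind : IndepFun (fun ω => S.stepLinear n t
      (S.randomState g init noise t ω, S.randomAction g init noise t ω))
      (fun ω a => noise t a ω) μ := by
    have hφ : Measurable fun h : Fin (t + 1) → State dx n =>
        S.stepLinear n t (h (Fin.last t), g t h) :=
      (S.measurable_stepLinear n t).comp ((measurable_pi_apply _).prodMk (hg t))
    exact (hA.indepFun_history_noise (S := S) hg ht).comp hφ measurable_id
  simp only [randomState_succ]
  rw [integral_bilinear_add_of_indepFun _ hf (hA.memLp_jointNoise ht) hind
    (hA.integral_jointNoise ht), ← add_assoc]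
  congr 1
  rw [← integral_add (integrable_stageCost hn t hx hu) (integrable_bilinear _ hf hf),
    ← integral_add (integrable_bilinear _ hx hx) (integrable_excess T t hx hu)]
  refine integral_congr_ae (Eventually.of_forall fun ω => ?_)
  simp only [stepLinear_apply]
  exact stageCost_add_value hn hpos ht _ _

omit [MeasurableSpace Ω] in
theorem totalCost_eq (g : Strategy dx du n) (init : Agent n → Ω → Fin dx → ℝ)
    (noise : ℕ → Agent n → Ω → Fin dx → ℝ) (ω : Ω) :
    S.totalCost T g (fun a => init a ω) (fun t a => noise t a ω)
      = ∑ t ∈ Finset.range T,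
          S.stageCost t (S.randomState g init noise t ω) (S.randomAction g init noise t ω) := rfl

omit [MeasurableSpace Ω] in
theorem totalCost_nonneg (hn : n ≠ 0) (hpos : S.PositiveWeights T) (g : Strategy dx du n)
    (init : Agent n → Ω → Fin dx → ℝ) (noise : ℕ → Agent n → Ω → Fin dx → ℝ) (ω : Ω) :
    0 ≤ S.totalCost T g (fun a => init a ω) (fun t a => noise t a ω) :=
  Finset.sum_nonneg fun _ ht => stageCost_nonneg hn hpos (Finset.mem_range.1 ht) _ _

/-- With square integrable actions, the cost is the uncontrollable part plus the expected excess. -/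
theorem cost_eq_baseCost_add (hn : n ≠ 0) (hpos : S.PositiveWeights T)
    (hA : PrimitiveAssumptions T μ init noise m covX covW) (hg : ∀ t, Measurable (g t))
    (hu : ∀ t < T, MemLp (S.randomAction g init noise t) 2 μ) :
    S.cost T μ init noise g = ((S.baseCost T μ init noise + ∑ t ∈ Finset.range T,
      ∫ ω, S.excess T t (S.randomState g init noise t ω)
        (S.randomAction g init noise t ω) ∂μ : ℝ) : EReal) := by
  have hx : ∀ t ≤ T, MemLp (S.randomState g init noise t) 2 μ := fun _ ht =>
    memLp_state hA ht fun s hs => hu s (by omega)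
  have hi : ∀ t ∈ Finset.range T, Integrable (fun ω =>
      S.stageCost t (S.randomState g init noise t ω) (S.randomAction g init noise t ω)) μ :=
    fun t ht => by
      have ht' := Finset.mem_range.1 ht
      exact integrable_stageCost hn t (hx t ht'.le) (hu t ht')
  rw [cost, extExpectation_eq_integral (totalCost_nonneg hn hpos g init noise)]
  swap
  · simp only [totalCost_eq]
    exact integrable_finsetSum _ hi
  simp only [totalCost_eq]
  rw [integral_finsetSum _ hi, EReal.coe_eq_coe_iff]
  have key : ∀ k ≤ T, ∑ t ∈ Finset.range k, ∫ ω, S.stageCost t (S.randomState g init noise t ω)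
        (S.randomAction g init noise t ω) ∂μ
      + ∫ ω, S.valueForm n T k (S.randomState g init noise k ω)
          (S.randomState g init noise k ω) ∂μ
      = ∫ ω, S.valueForm n T 0 (fun a => init a ω) (fun a => init a ω) ∂μ
      + ∑ t ∈ Finset.range k,
          ∫ ω, S.valueForm n T (t + 1) (fun a => noise t a ω) (fun a => noise t a ω) ∂μ
      + ∑ t ∈ Finset.range k, ∫ ω, S.excess T t (S.randomState g init noise t ω)
          (S.randomAction g init noise t ω) ∂μ := by
    intro k hk
    induction k with
    | zero => simp [randomState, state_zero]
    | succ k ih =>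
      simp only [Finset.sum_range_succ]
      have h := integral_stageCost_add_value hn hpos hA hg hk (hx k (by omega)) (hu k hk)
      linarith [ih (by omega)]
  -- the terminal value vanishes
  have h := key T le_rfl
  simp only [valueForm_terminal, LinearMap.zero_apply, integral_zero, add_zero] at h
  rw [h, baseCost]

omit [IsProbabilityMeasure μ] in
/-- A strategy of finite cost has square integrable actions. -/
theorem memLp_action_of_cost_ne_top (hn : n ≠ 0) (hpos : S.PositiveWeights T)
    (hA : PrimitiveAssumptions T μ init noise m covX covW) (hg : ∀ t, Measurable (g t))
    (hc : S.cost T μ init noise g ≠ ⊤) {t : ℕ} (ht : t < T) :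
    MemLp (S.randomAction g init noise t) 2 μ := by
  rw [cost, extExpectation_of_nonneg (totalCost_nonneg hn hpos g init noise)] at hc
  have hfin : ∫⁻ ω, ENNReal.ofReal
      (S.totalCost T g (fun a => init a ω) (fun t a => noise t a ω)) ∂μ ≠ ⊤ := fun h => by
    rw [h] at hc
    exact hc rfl
  have hU := hA.measurable_action (S := S) hg ht.le
  obtain ⟨c, hc0, hle⟩ := exists_norm_sq_le_stageCost (S := S) hn hpos ht
  refine MemLp.of_eval fun a => ?_
  have hUa : Measurable fun ω => S.randomAction g init noise t ω a :=
    (measurable_pi_apply a).comp hU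
  rw [memLp_two_iff_integrable_sq_norm hUa.aestronglyMeasurable]
  refine ⟨(hUa.norm.pow_const 2).aestronglyMeasurable, ?_⟩
  rw [hasFiniteIntegral_iff_ofReal (Eventually.of_forall fun ω => by positivity)]
  have hpt : ∀ ω, ENNReal.ofReal (‖S.randomAction g init noise t ω a‖ ^ 2)
      ≤ ENNReal.ofReal c⁻¹ * ENNReal.ofReal
        (S.totalCost T g (fun a => init a ω) (fun t a => noise t a ω)) := fun ω => by
    rw [← ENNReal.ofReal_mul (by positivity)]
    refine ENNReal.ofReal_le_ofReal ?_
    have h1 := hle (S.randomState g init noise t ω) (S.randomAction g init noise t ω) a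
    have h2 : S.stageCost t (S.randomState g init noise t ω) (S.randomAction g init noise t ω)
        ≤ S.totalCost T g (fun a => init a ω) (fun t a => noise t a ω) := by
      rw [totalCost_eq]
      exact Finset.single_le_sum (f := fun t => S.stageCost t (S.randomState g init noise t ω)
        (S.randomAction g init noise t ω))
        (fun s hs => stageCost_nonneg hn hpos (Finset.mem_range.1 hs) _ _) (Finset.mem_range.2 ht)
    rw [← div_eq_inv_mul, le_div_iff₀ hc0]
    linarith
  refine (lintegral_mono hpt).trans_lt ?_
  rw [lintegral_const_mul' _ _ ENNReal.ofReal_ne_top]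
  exact ENNReal.mul_lt_top ENNReal.ofReal_lt_top hfin.lt_top

/-- No strategy measurable in the joint history beats `baseCost`; a strategy of infinite cost has
nothing to prove. -/
theorem baseCost_le_cost (hn : n ≠ 0) (hpos : S.PositiveWeights T)
    (hA : PrimitiveAssumptions T μ init noise m covX covW) (hg : ∀ t, Measurable (g t)) :
    (S.baseCost T μ init noise : EReal) ≤ S.cost T μ init noise g := by
  by_cases hc : S.cost T μ init noise g = ⊤
  · rw [hc]
    exact le_top
  · rw [cost_eq_baseCost_add hn hpos hA hg
      fun t ht => memLp_action_of_cost_ne_top hn hpos hA hg hc ht, EReal.coe_le_coe_iff]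
    exact le_add_of_nonneg_right (Finset.sum_nonneg fun t ht =>
      integral_nonneg fun ω => excess_nonneg hpos (Finset.mem_range.1 ht) _ _)

end LQSystem

/-! ### The two feedback strategies and the error of the mean-field proxy -/

theorem avg_comp_mulVec_add {d e n : ℕ} (hn : n ≠ 0) (L : Matrix (Fin d) (Fin e) ℝ)
    (x : Agent n → Fin e → ℝ) (u : Agent n → Fin d → ℝ) (c : Fin d → ℝ)
    (h : ∀ i, u (some i) = L *ᵥ x (some i) + c) : avg u = L *ᵥ avg x + c := by
  have hn' : (n : ℝ) ≠ 0 := by exact_mod_cast hn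
  simp only [avg, h, Finset.sum_add_distrib, ← mulVec_sum, smul_add, ← mulVec_smul,
    Finset.sum_const, Finset.card_univ, Fintype.card_fin]
  rw [← Nat.cast_smul_eq_nsmul ℝ, smul_smul, inv_mul_cancel₀ hn', one_smul]

theorem fromBlocks_toBlocks_mulVec_elim {α β γ δ : Type*} [Fintype γ] [Fintype δ]
    (L : Matrix (α ⊕ β) (γ ⊕ δ) ℝ) (a : γ → ℝ) (b : δ → ℝ) :
    L *ᵥ Sum.elim a b = Sum.elim (L.toBlocks₁₁ *ᵥ a + L.toBlocks₁₂ *ᵥ b)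
      (L.toBlocks₂₁ *ᵥ a + L.toBlocks₂₂ *ᵥ b) := by
  conv_lhs => rw [← fromBlocks_toBlocks L]
  rw [fromBlocks_mulVec, Sum.elim_comp_inl, Sum.elim_comp_inr]

namespace LQSystem

variable {dx du n T : ℕ} {S : LQSystem dx du}

variable (S) in
/-- The feedback law common to the two strategies: `z` stands for the mean-field or for a proxy of
it. -/
noncomputable def feedback (T t : ℕ) (x : State dx n) (z : Fin dx → ℝ) : Action du n
  | none => (S.Lbar T t).toBlocks₁₁ *ᵥ x none + (S.Lbar T t).toBlocks₁₂ *ᵥ z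
  | some i =>
      S.Lbreve T t *ᵥ x (some i) + (S.Lbar T t).toBlocks₂₁ *ᵥ x none
        + ((S.Lbar T t).toBlocks₂₂ - S.Lbreve T t) *ᵥ z

theorem avg_feedback (hn : n ≠ 0) (t : ℕ) (x : State dx n) (z : Fin dx → ℝ) :
    avg (S.feedback T t x z) = S.Lbreve T t *ᵥ avg x + ((S.Lbar T t).toBlocks₂₁ *ᵥ x none
        + ((S.Lbar T t).toBlocks₂₂ - S.Lbreve T t) *ᵥ z) :=
  avg_comp_mulVec_add hn _ x _ _ fun i => by simp only [feedback, add_assoc]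

/-- Replacing the mean-field by `z` does not disturb the optimal control of the deviations; the
excess is a quadratic form in the error `x̄ - z`. -/
theorem excess_feedback (hn : n ≠ 0) (t : ℕ) (x : State dx n) (z : Fin dx → ℝ) :
    S.excess T t x (S.feedback T t x z) =
      quadForm (controlWeight S.Abar S.Bbar S.Qbar S.Rbar T t)
        (fromRows (S.Lbar T t).toBlocks₁₂ ((S.Lbar T t).toBlocks₂₂ - S.Lbreve T t)
          *ᵥ (avg x - z)) := by
  have h1 : ∀ i, dev (S.feedback T t x z) i - S.Lbreve T t *ᵥ dev x i = 0 := fun i => by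
    simp only [dev, avg_feedback hn, feedback, mulVec_sub]
    abel
  have h2 : leaderMean (S.feedback T t x z) - S.Lbar T t *ᵥ leaderMean x =
      -(fromRows (S.Lbar T t).toBlocks₁₂ ((S.Lbar T t).toBlocks₂₂ - S.Lbreve T t)
          *ᵥ (avg x - z)) := by
    rw [leaderMean, leaderMean, fromBlocks_toBlocks_mulVec_elim, avg_feedback hn, fromRows_mulVec]
    ext k
    rcases k with k | k
    · simp [feedback, mulVec_sub]
    · simp [sub_mulVec, mulVec_sub]
      ring
  simp only [excess, h1, h2, quadForm_zero, Finset.sum_const_zero, mul_zero, zero_add,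
    quadForm_neg]

theorem action_linearStrategy (x1 : State dx n) (w : ℕ → State dx n) (t : ℕ) :
    S.action (S.linearStrategy n T) x1 w t =
      S.feedback T t (S.state (S.linearStrategy n T) x1 w t)
        (avg (S.state (S.linearStrategy n T) x1 w t)) := by
  ext a : 1
  cases a <;> rfl

theorem zPath_congr (m : Fin dx → ℝ) {p q : ℕ → Fin dx → ℝ} {t : ℕ} (h : ∀ s < t, p s = q s) :
    S.zPath T m p t = S.zPath T m q t := by
  induction t with
  | zero => rfl
  | succ t ih =>
    simp only [zPath, ih fun s hs => h s (by omega), h t (by omega)]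

theorem action_proposedStrategy (m : Fin dx → ℝ) (x1 : State dx n) (w : ℕ → State dx n) (t : ℕ) :
    S.action (S.proposedStrategy n T m) x1 w t =
      S.feedback T t (S.state (S.proposedStrategy n T m) x1 w t)
        (S.zPath T m (fun s => S.state (S.proposedStrategy n T m) x1 w s none) t) := by
  have h : S.zPath T m (fun s => S.history (S.proposedStrategy n T m) x1 w t
        ⟨min s t, by omega⟩ none) t
      = S.zPath T m (fun s => S.state (S.proposedStrategy n T m) x1 w s none) t :=
    zPath_congr m fun s hs => by
      simp only [history_apply, min_eq_left hs.le]
  rw [← h]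
  ext a : 1
  cases a <;> rfl

/-- The error of the proxy `z` for the mean-field obeys an autonomous linear recursion driven by
the averaged noise: the leader's state cancels. -/
theorem avg_state_sub_zPath_succ (hn : n ≠ 0) (m : Fin dx → ℝ) (x1 : State dx n)
    (w : ℕ → State dx n) (t : ℕ) :
    avg (S.state (S.proposedStrategy n T m) x1 w (t + 1))
        - S.zPath T m (fun s => S.state (S.proposedStrategy n T m) x1 w s none) (t + 1)
      = (S.A t + S.D t + S.B t * S.Lbreve T t) *ᵥ
          (avg (S.state (S.proposedStrategy n T m) x1 w t)
            - S.zPath T m (fun s => S.state (S.proposedStrategy n T m) x1 w s none) t)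
        + avg (w t) := by
  rw [state_succ, avg_step S hn, action_proposedStrategy, avg_feedback hn, zPath]
  simp only [add_mulVec, sub_mulVec, mulVec_add, mulVec_sub, ← mulVec_mulVec]
  abel

theorem dotProduct_self_nonneg_real {ι : Type*} [Fintype ι] (v : ι → ℝ) : 0 ≤ v ⬝ᵥ v :=
  Finset.sum_nonneg fun i _ => mul_self_nonneg (v i)

theorem dotProduct_self_add_le {ι : Type*} [Fintype ι] (v w : ι → ℝ) :
    (v + w) ⬝ᵥ (v + w) ≤ 2 * (v ⬝ᵥ v) + 2 * (w ⬝ᵥ w) := by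
  have h := dotProduct_self_nonneg_real (v - w)
  simp only [add_dotProduct, dotProduct_add, sub_dotProduct, dotProduct_sub] at h ⊢
  linarith

theorem exists_dotProduct_mulVec_self_le {ι κ : Type*} [Fintype ι] [Fintype κ]
    (G : Matrix ι κ ℝ) : ∃ C : ℝ, 0 ≤ C ∧ ∀ v, (G *ᵥ v) ⬝ᵥ (G *ᵥ v) ≤ C * (v ⬝ᵥ v) := by
  obtain ⟨C, hC, h⟩ := exists_quadForm_le (Gᵀ * G)
  refine ⟨C, hC, fun v => ?_⟩
  rw [dotProduct_comm, ← transpose_transpose G, ← dotProduct_mulVec_eq_transpose,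
    transpose_transpose, mulVec_mulVec]
  exact h v

variable (S T) in
/-- The error of the proxy is bounded by the initial sampling error and the averaged noises, with a
constant that depends neither on the number of followers nor on the realization. -/
theorem exists_error_le (t : ℕ) : ∃ c : ℝ, 0 ≤ c ∧ ∀ (n : ℕ) (_ : n ≠ 0) (m : Fin dx → ℝ)
    (x1 : State dx n) (w : ℕ → State dx n),
    (avg (S.state (S.proposedStrategy n T m) x1 w t)
        - S.zPath T m (fun s => S.state (S.proposedStrategy n T m) x1 w s none) t) ⬝ᵥ
      (avg (S.state (S.proposedStrategy n T m) x1 w t)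
        - S.zPath T m (fun s => S.state (S.proposedStrategy n T m) x1 w s none) t)
      ≤ c * ((avg x1 - m) ⬝ᵥ (avg x1 - m) + ∑ s ∈ Finset.range t, avg (w s) ⬝ᵥ avg (w s)) := by
  induction t with
  | zero => exact ⟨1, zero_le_one, fun n _ m x1 w => by simp [state_zero, zPath]⟩
  | succ t ih =>
    obtain ⟨c, hc, h⟩ := ih
    obtain ⟨C, hC, hG⟩ :=
      exists_dotProduct_mulVec_self_le (S.A t + S.D t + S.B t * S.Lbreve T t)
    refine ⟨2 * C * c + 2, by positivity, fun n hn m x1 w => ?_⟩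
    rw [avg_state_sub_zPath_succ hn, Finset.sum_range_succ]
    refine (dotProduct_self_add_le _ _).trans ?_
    have h1 := (hG _).trans (mul_le_mul_of_nonneg_left (h n hn m x1 w) hC)
    have h2 := dotProduct_self_nonneg_real (avg x1 - m)
    have h3 : 0 ≤ ∑ s ∈ Finset.range t, avg (w s) ⬝ᵥ avg (w s) :=
      Finset.sum_nonneg fun s _ => dotProduct_self_nonneg_real _
    have h4 := dotProduct_self_nonneg_real (avg (w t))
    have h5 : 0 ≤ C * c * (avg (w t) ⬝ᵥ avg (w t)) := by positivity
    nlinarith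

variable (S T) in
theorem exists_sum_excess_le : ∃ c : ℝ, 0 ≤ c ∧ ∀ (n : ℕ) (_ : n ≠ 0) (m : Fin dx → ℝ)
    (x1 : State dx n) (w : ℕ → State dx n),
    ∑ t ∈ Finset.range T, S.excess T t (S.state (S.proposedStrategy n T m) x1 w t)
        (S.action (S.proposedStrategy n T m) x1 w t)
      ≤ c * ((avg x1 - m) ⬝ᵥ (avg x1 - m) + ∑ s ∈ Finset.range T, avg (w s) ⬝ᵥ avg (w s)) := by
  choose c hc h using exists_error_le T S
  choose C hC hG using fun t => exists_dotProduct_mulVec_self_le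
    (fromRows (S.Lbar T t).toBlocks₁₂ ((S.Lbar T t).toBlocks₂₂ - S.Lbreve T t))
  choose K hK hW using fun t => exists_quadForm_le (controlWeight S.Abar S.Bbar S.Qbar S.Rbar T t)
  refine ⟨∑ t ∈ Finset.range T, K t * (C t * c t),
    Finset.sum_nonneg fun t _ => mul_nonneg (hK t) (mul_nonneg (hC t) (hc t)),
    fun n hn m x1 w => ?_⟩
  rw [Finset.sum_mul]
  refine Finset.sum_le_sum fun t ht => ?_
  have hmono : ∑ s ∈ Finset.range t, avg (w s) ⬝ᵥ avg (w s)
      ≤ ∑ s ∈ Finset.range T, avg (w s) ⬝ᵥ avg (w s) :=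
    Finset.sum_le_sum_of_subset_of_nonneg
      (Finset.range_subset_range.2 (Finset.mem_range.1 ht).le) fun s _ _ =>
        dotProduct_self_nonneg_real _
  rw [action_proposedStrategy, excess_feedback hn, mul_assoc, mul_assoc]
  refine (hW t _).trans (mul_le_mul_of_nonneg_left ((hG t _).trans
    (mul_le_mul_of_nonneg_left ((h t n hn m x1 w).trans ?_) (hC t))) (hK t))
  gcongr
  exact hc t

end LQSystem

/-! ### Averages of independent vectors -/

section SampleMean

variable {Ω : Type*} [MeasurableSpace Ω] {μ : Measure Ω} [IsProbabilityMeasure μ]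

/-- The mean square error of the average of `n` independent vectors with common mean and
covariance matrix. -/
theorem integral_avg_sub_sq {d n : ℕ} (hn : n ≠ 0) {Y : Agent n → Ω → Fin d → ℝ} {m : Fin d → ℝ}
    {C : Matrix (Fin d) (Fin d) ℝ} (hY : ∀ i : Fin n, MemLp (Y (some i)) 2 μ)
    (hind : ∀ i j : Fin n, i ≠ j → IndepFun (Y (some i)) (Y (some j)) μ)
    (hm : ∀ (i : Fin n) k, ∫ ω, Y (some i) ω k ∂μ = m k)
    (hC : ∀ (i : Fin n) k,
      cov[fun ω => Y (some i) ω k, fun ω => Y (some i) ω k; μ] = C k k) :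
    Integrable (fun ω => (avg (fun a => Y a ω) - m) ⬝ᵥ (avg (fun a => Y a ω) - m)) μ ∧
    ∫ ω, (avg (fun a => Y a ω) - m) ⬝ᵥ (avg (fun a => Y a ω) - m) ∂μ = C.trace / n := by
  have hn' : (n : ℝ) ≠ 0 := by exact_mod_cast hn
  have hYk : ∀ (i : Fin n) k, MemLp (fun ω => Y (some i) ω k) 2 μ := fun i k => (hY i).eval k
  have hval : ∀ ω k, avg (fun a => Y a ω) k
      = (n : ℝ)⁻¹ * (∑ i : Fin n, fun ω => Y (some i) ω k) ω :=
    fun ω k => by simp [avg]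
  have hL : ∀ k, MemLp (fun ω => avg (fun a => Y a ω) k) 2 μ := fun k => by
    simp only [hval]
    exact (memLp_finsetSum' _ fun i _ => hYk i k).const_mul _
  have hmean : ∀ k, ∫ ω, avg (fun a => Y a ω) k ∂μ = m k := fun k => by
    simp only [hval, Finset.sum_apply]
    rw [integral_const_mul, integral_finsetSum _ fun i _ => (hYk i k).integrable (by norm_num)]
    simp only [hm, Finset.sum_const, Finset.card_univ, Fintype.card_fin, nsmul_eq_mul]
    field_simp
  have hvar : ∀ k, ∫ ω, (avg (fun a => Y a ω) k - m k) ^ 2 ∂μ = C k k / n := fun k => by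
    -- the mean square error is the variance, which is additive by independence
    have h := variance_eq_integral (μ := μ) (hL k).aemeasurable
    rw [hmean] at h
    rw [← h]
    simp only [hval]
    rw [variance_const_mul, IndepFun.variance_sum fun i _ => hYk i k]
    · have hv : ∀ i : Fin n, Var[fun ω => Y (some i) ω k; μ] = C k k := fun i => by
        rw [← covariance_self (hYk i k).aemeasurable, hC]
      simp only [hv, Finset.sum_const, Finset.card_univ, Fintype.card_fin, nsmul_eq_mul]
      field_simp
    · intro i _ j _ hij
      exact (hind i j hij).comp (measurable_pi_apply k) (measurable_pi_apply k)
  have hsq : ∀ ω, (avg (fun a => Y a ω) - m) ⬝ᵥ (avg (fun a => Y a ω) - m)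
      = ∑ k, (avg (fun a => Y a ω) k - m k) ^ 2 := fun ω => by
    simp [dotProduct, sq]
  have hi : ∀ k, Integrable (fun ω => (avg (fun a => Y a ω) k - m k) ^ 2) μ := fun k =>
    ((hL k).sub (memLp_const (m k))).integrable_sq
  simp only [hsq]
  refine ⟨integrable_finsetSum _ fun k _ => hi k, ?_⟩
  rw [integral_finsetSum _ fun k _ => hi k]
  simp only [hvar, trace, diag_apply, Finset.sum_div]

end SampleMean

/-! ### Costs of the two strategies -/

namespace LQSystem

variable {dx du n T : ℕ} {S : LQSystem dx du} {Ω : Type*} [MeasurableSpace Ω] {μ : Measure Ω}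
  [IsProbabilityMeasure μ] {init : Agent n → Ω → Fin dx → ℝ}
  {noise : ℕ → Agent n → Ω → Fin dx → ℝ} {m : Fin dx → ℝ} {covX covW : Matrix (Fin dx) (Fin dx) ℝ}

theorem integral_init_error (hn : n ≠ 0)
    (hA : PrimitiveAssumptions T μ init noise m covX covW) :
    Integrable (fun ω => (avg (fun a => init a ω) - m) ⬝ᵥ (avg (fun a => init a ω) - m)) μ ∧
    ∫ ω, (avg (fun a => init a ω) - m) ⬝ᵥ (avg (fun a => init a ω) - m) ∂μ = covX.trace / n :=
  integral_avg_sub_sq hn (fun i => hA.memLp_init (some i))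
    (fun i j hij => hA.indep.indepFun (i := Sum.inl (some i)) (j := Sum.inl (some j))
      (by simpa using hij))
    hA.init_mean fun i k => hA.init_cov i k k

theorem integral_noise_avg (hn : n ≠ 0)
    (hA : PrimitiveAssumptions T μ init noise m covX covW) {t : ℕ} (ht : t < T) :
    Integrable (fun ω => avg (fun a => noise t a ω) ⬝ᵥ avg (fun a => noise t a ω)) μ ∧
    ∫ ω, avg (fun a => noise t a ω) ⬝ᵥ avg (fun a => noise t a ω) ∂μ = covW.trace / n := by
  have h := integral_avg_sub_sq (m := 0) hn (fun i => hA.memLp_noise t ht (some i))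
    (fun i j hij => hA.indep.indepFun (i := Sum.inr (⟨t, ht⟩, some i))
      (j := Sum.inr (⟨t, ht⟩, some j)) (by simpa using hij))
    (fun i k => hA.noise_mean t ht (some i) k) fun i k => hA.noise_cov t ht i k k
  simpa only [sub_zero] using h

omit [IsProbabilityMeasure μ] in
theorem memLp_feedback (t : ℕ) {x : Ω → State dx n} {z : Ω → Fin dx → ℝ} (hx : MemLp x 2 μ)
    (hz : MemLp z 2 μ) : MemLp (fun ω => S.feedback T t (x ω) (z ω)) 2 μ := by
  refine MemLp.of_eval fun a => ?_
  have hxa : ∀ a, MemLp (fun ω => x ω a) 2 μ := hx.eval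
  cases a with
  | none =>
    simp only [feedback]
    exact MemLp.add (memLp_mulVec _ (hxa none)) (memLp_mulVec _ hz)
  | some i =>
    simp only [feedback]
    exact MemLp.add (MemLp.add (memLp_mulVec _ (hxa (some i))) (memLp_mulVec _ (hxa none)))
      (memLp_mulVec _ hz)

omit [IsProbabilityMeasure μ] in
theorem memLp_action_linearStrategy (hA : PrimitiveAssumptions T μ init noise m covX covW)
    {t : ℕ} (ht : t ≤ T) : MemLp (S.randomAction (S.linearStrategy n T) init noise t) 2 μ := by
  induction t using Nat.strong_induction_on with
  | h t ih =>
    have hx := memLp_state (S := S) (g := S.linearStrategy n T) hA ht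
      fun s hs => ih s hs (by omega)
    unfold randomAction
    simp only [action_linearStrategy]
    exact memLp_feedback t hx (memLp_avg hx)

theorem memLp_zPath (m : Fin dx → ℝ) {p : ℕ → Ω → Fin dx → ℝ} {t : ℕ}
    (hp : ∀ s < t, MemLp (p s) 2 μ) : MemLp (fun ω => S.zPath T m (fun s => p s ω) t) 2 μ := by
  induction t with
  | zero => exact memLp_const m
  | succ t ih =>
    simp only [zPath]
    exact MemLp.add (memLp_mulVec _ (ih fun s hs => hp s (by omega)))
      (memLp_mulVec _ (hp t (by omega)))

theorem memLp_action_proposedStrategy (hA : PrimitiveAssumptions T μ init noise m covX covW)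
    {t : ℕ} (ht : t ≤ T) :
    MemLp (S.randomAction (S.proposedStrategy n T m) init noise t) 2 μ := by
  induction t using Nat.strong_induction_on with
  | h t ih =>
    have hx : ∀ s ≤ t, MemLp (S.randomState (S.proposedStrategy n T m) init noise s) 2 μ :=
      fun s hs => memLp_state hA (by omega) fun r hr => ih r (by omega) (by omega)
    unfold randomAction
    simp only [action_proposedStrategy]
    have hz := memLp_zPath (S := S) (T := T) m
      (p := fun s ω => S.randomState (S.proposedStrategy n T m) init noise s ω none)
      fun s hs => (hx s hs.le).eval none
    exact memLp_feedback t (hx t le_rfl) hz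

theorem isMeanFieldSharing_linearStrategy : IsMeanFieldSharing (S.linearStrategy n T) := by
  refine ⟨fun t => ⟨fun p => (S.Lbar T t).toBlocks₁₁ *ᵥ p.1 (Fin.last t)
      + (S.Lbar T t).toBlocks₁₂ *ᵥ p.2 (Fin.last t), ?_, fun h => rfl⟩,
    fun i t => ⟨fun p => S.Lbreve T t *ᵥ p.1 (Fin.last t)
      + (S.Lbar T t).toBlocks₂₁ *ᵥ p.2.1 (Fin.last t)
      + ((S.Lbar T t).toBlocks₂₂ - S.Lbreve T t) *ᵥ p.2.2 (Fin.last t), ?_, fun h => rfl⟩⟩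
  · exact Continuous.measurable (by fun_prop)
  · exact Continuous.measurable (by fun_prop)

theorem continuous_zPath {X : Type*} [TopologicalSpace X] (m : Fin dx → ℝ)
    {p : X → ℕ → Fin dx → ℝ} (hp : ∀ s, Continuous fun x => p x s) (t : ℕ) :
    Continuous fun x => S.zPath T m (p x) t := by
  induction t with
  | zero => exact continuous_const
  | succ t ih =>
    have := hp t
    simp only [zPath]
    fun_prop

theorem isDecentralized_proposedStrategy (m : Fin dx → ℝ) :
    IsDecentralized (S.proposedStrategy n T m) := by
  refine ⟨fun t => ⟨fun p => (S.Lbar T t).toBlocks₁₁ *ᵥ p (Fin.last t)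
      + (S.Lbar T t).toBlocks₁₂ *ᵥ S.zPath T m (fun s => p ⟨min s t, by omega⟩) t, ?_,
      fun h => rfl⟩,
    fun i t => ⟨fun p => S.Lbreve T t *ᵥ p.1 (Fin.last t)
      + (S.Lbar T t).toBlocks₂₁ *ᵥ p.2 (Fin.last t)
      + ((S.Lbar T t).toBlocks₂₂ - S.Lbreve T t) *ᵥ
        S.zPath T m (fun s => p.2 ⟨min s t, by omega⟩) t, ?_, fun h => rfl⟩⟩
  · have hz := continuous_zPath (S := S) (T := T) m
      (p := fun (p : Fin (t + 1) → Fin dx → ℝ) s => p ⟨min s t, by omega⟩)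
      (fun s => continuous_apply _) t
    exact Continuous.measurable (by fun_prop)
  · have hz := continuous_zPath (S := S) (T := T) m
      (p := fun (p : (Fin (t + 1) → Fin dx → ℝ) × (Fin (t + 1) → Fin dx → ℝ)) s =>
        p.2 ⟨min s t, by omega⟩)
      (fun s => (continuous_apply _).comp continuous_snd) t
    exact Continuous.measurable (by fun_prop)

/-- The linear mean-field feedback has no excess, so its cost is the uncontrollable part. -/
theorem cost_linearStrategy (hn : n ≠ 0) (hpos : S.PositiveWeights T)
    (hA : PrimitiveAssumptions T μ init noise m covX covW) :
    S.cost T μ init noise (S.linearStrategy n T) = (S.baseCost T μ init noise : EReal) := by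
  rw [cost_eq_baseCost_add hn hpos hA isMeanFieldSharing_linearStrategy.measurable
    fun t ht => memLp_action_linearStrategy hA ht.le]
  have h : ∀ t ω, S.excess T t (S.randomState (S.linearStrategy n T) init noise t ω)
      (S.randomAction (S.linearStrategy n T) init noise t ω) = 0 := fun t ω => by
    rw [randomAction, action_linearStrategy]
    exact (excess_feedback hn t _ _).trans (by rw [randomState, sub_self]; simp)
  simp [h]

theorem optimalCost_eq (hn : n ≠ 0) (hpos : S.PositiveWeights T)
    (hA : PrimitiveAssumptions T μ init noise m covX covW) :
    S.optimalCost T μ init noise = (S.baseCost T μ init noise : EReal) := by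
  refine le_antisymm ?_ (le_iInf fun g => baseCost_le_cost hn hpos hA g.2.measurable)
  rw [← cost_linearStrategy hn hpos hA]
  exact iInf_le (fun g : {g : Strategy dx du n // IsMeanFieldSharing g} => S.cost T μ init noise g.1)
    ⟨_, isMeanFieldSharing_linearStrategy⟩

variable (S T) in
/-- The loss of the proposed strategy against the optimal performance is of order `1 / n`. -/
theorem exists_cost_proposedStrategy (hpos : S.PositiveWeights T)
    (covX covW : Matrix (Fin dx) (Fin dx) ℝ) :
    ∃ c : ℝ, 0 ≤ c ∧ ∀ (n : ℕ), n ≠ 0 → ∀ {Ω : Type*} [MeasurableSpace Ω] (μ : Measure Ω)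
      [IsProbabilityMeasure μ] (init : Agent n → Ω → Fin dx → ℝ)
      (noise : ℕ → Agent n → Ω → Fin dx → ℝ) (m : Fin dx → ℝ),
      PrimitiveAssumptions T μ init noise m covX covW →
      ∃ δ : ℝ, 0 ≤ δ ∧ δ ≤ c / n ∧ S.cost T μ init noise (S.proposedStrategy n T m)
        = ((S.baseCost T μ init noise + δ : ℝ) : EReal) := by
  obtain ⟨c, hc, h⟩ := exists_sum_excess_le T S
  refine ⟨c * (|covX.trace| + T * |covW.trace|), by positivity,
    fun n hn Ω _ μ _ init noise m hA => ?_⟩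
  have hu := fun t (ht : t < T) => memLp_action_proposedStrategy (S := S) hA ht.le
  refine ⟨_, ?_, ?_, cost_eq_baseCost_add hn hpos hA
    (isDecentralized_proposedStrategy m).isMeanFieldSharing.measurable hu⟩
  · exact Finset.sum_nonneg fun t ht =>
      integral_nonneg fun ω => excess_nonneg hpos (Finset.mem_range.1 ht) _ _
  · have hi : ∀ t ∈ Finset.range T, Integrable (fun ω => S.excess T t
        (S.randomState (S.proposedStrategy n T m) init noise t ω)
        (S.randomAction (S.proposedStrategy n T m) init noise t ω)) μ := fun t ht =>
      have ht' := Finset.mem_range.1 ht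
      integrable_excess T t (memLp_state hA ht'.le fun s hs => hu s (by omega)) (hu t ht')
    obtain ⟨i0, e0⟩ := integral_init_error hn hA
    have hw := fun t (ht : t ∈ Finset.range T) => integral_noise_avg hn hA (Finset.mem_range.1 ht)
    have iw := integrable_finsetSum _ fun t ht => (hw t ht).1
    rw [← integral_finsetSum _ hi]
    have hle : ∀ ω, ∑ t ∈ Finset.range T, S.excess T t
          (S.randomState (S.proposedStrategy n T m) init noise t ω)
          (S.randomAction (S.proposedStrategy n T m) init noise t ω)
        ≤ c * ((avg (fun a => init a ω) - m) ⬝ᵥ (avg (fun a => init a ω) - m)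
            + ∑ t ∈ Finset.range T,
              avg (fun a => noise t a ω) ⬝ᵥ avg (fun a => noise t a ω)) := fun ω =>
      h n hn m (fun a => init a ω) (fun t a => noise t a ω)
    calc _ ≤ ∫ ω, c * ((avg (fun a => init a ω) - m) ⬝ᵥ (avg (fun a => init a ω) - m)
            + ∑ t ∈ Finset.range T,
              avg (fun a => noise t a ω) ⬝ᵥ avg (fun a => noise t a ω)) ∂μ :=
          integral_mono (integrable_finsetSum _ hi) ((i0.add iw).const_mul c) hle
      _ = c * (covX.trace / n + T * (covW.trace / n)) := by
          rw [integral_const_mul, integral_add i0 iw, e0,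
            integral_finsetSum _ fun t ht => (hw t ht).1,
            Finset.sum_congr rfl fun t ht => (hw t ht).2]
          simp
      _ = c * (covX.trace + T * covW.trace) / n := by ring
      _ ≤ c * (|covX.trace| + T * |covW.trace|) / n := by
          gcongr <;> exact le_abs_self _

end LQSystem

end LeaderFollower

theorem theorem2 {dx du : ℕ} (S : LQSystem dx du) (T : ℕ)
    (hsymm : S.SymmetricWeights T) (hpos : S.PositiveWeights T)
    (covX covW : Matrix (Fin dx) (Fin dx) ℝ) :
    ∃ ε : ℕ → ℝ, (∀ n, 0 ≤ ε n) ∧ Tendsto ε atTop (𝓝 0) ∧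
      ε =O[atTop] (fun n : ℕ => 1 / (n : ℝ)) ∧
      ∀ (n : ℕ), 1 ≤ n →
        ∀ {Ω : Type*} [MeasurableSpace Ω] (μ : Measure Ω) [IsProbabilityMeasure μ]
          (init : Agent n → Ω → Fin dx → ℝ) (noise : ℕ → Agent n → Ω → Fin dx → ℝ)
          (m : Fin dx → ℝ), PrimitiveAssumptions T μ init noise m covX covW →
          -- the proposed strategy respects the decentralized information structure
          IsDecentralized (S.proposedStrategy n T m) ∧
          -- it is `ε n`-optimal among all decentralized strategies
          (∀ g : Strategy dx du n, IsDecentralized g →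
            S.cost T μ init noise (S.proposedStrategy n T m)
              ≤ S.cost T μ init noise g + (ε n : EReal)) ∧
          -- the optimal performance is attained by the linear mean-field feedback strategy
          (IsMeanFieldSharing (S.linearStrategy n T) ∧
            S.cost T μ init noise (S.linearStrategy n T) = S.optimalCost T μ init noise) ∧
          -- both costs are finite and differ by at most `ε n`
          ∃ j jStar : ℝ, S.cost T μ init noise (S.proposedStrategy n T m) = (j : EReal) ∧
            S.optimalCost T μ init noise = (jStar : EReal) ∧ |j - jStar| ≤ ε n := by
  obtain ⟨c, hc, h⟩ := S.exists_cost_proposedStrategy T hpos covX covW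
  refine ⟨fun n => c / n, fun n => by positivity, tendsto_const_div_atTop_nhds_zero_nat c, ?_,
    fun n hn1 Ω _ μ _ init noise m hA => ?_⟩
  · simpa only [div_eq_mul_one_div c] using
      (isBigO_refl (fun n : ℕ => 1 / (n : ℝ)) atTop).const_mul_left c
  · have hn : n ≠ 0 := by omega
    obtain ⟨δ, hδ0, hδ, hcost⟩ := h n hn μ init noise m hA
    refine ⟨LQSystem.isDecentralized_proposedStrategy m, fun g hg => ?_,
      ⟨LQSystem.isMeanFieldSharing_linearStrategy, ?_⟩, _, _, hcost,
      LQSystem.optimalCost_eq hn hpos hA, ?_⟩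
    · rw [hcost, EReal.coe_add]
      exact add_le_add (LQSystem.baseCost_le_cost hn hpos hA hg.isMeanFieldSharing.measurable)
        (EReal.coe_le_coe_iff.2 hδ)
    · rw [LQSystem.cost_linearStrategy hn hpos hA, LQSystem.optimalCost_eq hn hpos hA]
    · rw [add_sub_cancel_left, abs_of_nonneg hδ0]
      exact hδ
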